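/- Consider a finite set $\mathcal S$ of users. For each unordered pair $\{i,j\}$ of different users, the timeline $[0,\infty)$ is divided alternately into contact times and inter-contact times (starting with either kind), forming an alternating renewal process: the contact times are exponential with parameter $\lambda^C_{i,j}$, the inter-contact times are exponential with parameter $\lambda^I_{i,j}$, all these durations are independent of each other and of the initial state, and the timelines of different pairs are independent. Let $H_{i,j}(t)=1$ if $i$ and $j$ are in contact at time $t$, and $H_{i,j}(t)=0$ otherwise. Let $x_{j,f}\in\{0,1\}$ indicate whether user $j$ caches file $f$, and let $$H_i^f(t)=1-\prod_{j\in\mathcal S\setminus\{i\},\,x_{j,f}=1}\bigl[1-H_{i,j}(t)\bigr].$$ For a delay threshold $T^d>0$, the communication time $T^c_{i,f}$ is the limit in distribution of $\int_{r}^{r+T^d}H_i^f(t)\,dt$ as the request time $r\to\infty$. Assume the homogeneous case: $\lambda^C_{i,j}=\lambda^C>0$ and $\lambda^I_{i,j}=\lambda^I>0$ for all $i\ne j$. If user $i$ requests a file $f$ that is not stored in its own cache ($x_{i,f}=0$), and $n_f=\sum_{j\in\mathcal S}x_{j,f}$ is the number of users caching $f$, then the limit $T^c_{i,f}$ exists,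 and $$\mathbb E[T^c_{i,f}]=T^d\left[1-\left(\frac{\lambda^C}{\lambda^C+\lambda^I}\right)^{n_f}\right],$$ $$\mathrm{Var}[T^c_{i,f}]=2\left[\frac{\lambda^C}{(\lambda^C+\lambda^I)^2}\right]^{n_f}\sum_{l=1}^{n_f}\binom{n_f}{l}\frac{(\lambda^C)^{n_f-l}(\lambda^I)^l}{l(\lambda^C+\lambda^I)}\left[T^d-\frac{1}{l(\lambda^C+\lambda^I)}+\frac{e^{-l(\lambda^C+\lambda^I)T^d}}{l(\lambda^C+\lambda^I)}\right].$$ -/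

import Mathlib

open MeasureTheory ProbabilityTheory Filter

namespace D2D

noncomputable section

/-- State of one alternating renewal process during its `n`-th phase (`n = 0, 1, 2, …`):
`true` means "in contact". It is the initial state when `n` is even, the other one when `n`
is odd. -/
def phaseState (s : Bool) (n : ℕ) : Bool := if n % 2 = 0 then s else !s

/-- Length of the `n`-th phase, when `c k` and `d k` are the lengths of the `k`-th contact time and
of the `k`-th inter-contact time (`k = 0, 1, 2, …`). -/
def phaseLength (s : Bool) (c d : ℕ → ℝ) (n : ℕ) : ℝ :=
  if phaseState s n = true then c (n / 2) else d (n / 2)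

/-- The instant at which the `n`-th phase begins. -/
def phaseStart (s : Bool) (c d : ℕ → ℝ) (n : ℕ) : ℝ :=
  ∑ m ∈ Finset.range n, phaseLength s c d m

open Classical in
/-- The contact indicator at time `t`: `1` if `t` lies in a phase of contact, `0` otherwise. -/
def contactIndicator (s : Bool) (c d : ℕ → ℝ) (t : ℝ) : ℝ :=
  if ∃ n, phaseState s n = true ∧ phaseStart s c d n ≤ t ∧ t < phaseStart s c d (n + 1)
  then 1 else 0

/-- The mobility model for a set `U` of users. For the unordered pair `e` of two different users,
`start e` tells whether the pair is in contact at time `0`, and `con e k`, `int e k` are the lengths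
of its `k`-th contact time and of its `k`-th inter-contact time. The contact times are
exponential with parameter `lamC e`, the inter-contact times are exponential with parameter
`lamI e`; all these durations are independent of each other and of the initial state (whose law is
arbitrary), and the timelines of different pairs are independent. Nothing is required on the
diagonal of `Sym2 U`. -/
structure IsMobilityModel {U Ω : Type*} [MeasurableSpace Ω] (lamC lamI : Sym2 U → ℝ)
    (start : Sym2 U → Ω → Bool) (con int : Sym2 U → ℕ → Ω → ℝ) (P : Measure Ω) : Prop where
  measurable_start : ∀ e, ¬ e.IsDiag → Measurable (start e)
  measurable_con : ∀ e, ¬ e.IsDiag → ∀ k, Measurable (con e k)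
  measurable_int : ∀ e, ¬ e.IsDiag → ∀ k, Measurable (int e k)
  law_con : ∀ e, ¬ e.IsDiag → ∀ k, P.map (con e k) = expMeasure (lamC e)
  law_int : ∀ e, ¬ e.IsDiag → ∀ k, P.map (int e k) = expMeasure (lamI e)
  indep_durations : ∀ e, ¬ e.IsDiag → iIndepFun (Sum.elim (con e) (int e)) P
  indep_start : ∀ e, ¬ e.IsDiag →
    IndepFun (start e) (fun ω => (fun k => con e k ω, fun k => int e k ω)) P
  indep_pairs : iIndepFun (fun (e : {e : Sym2 U // ¬ e.IsDiag}) ω =>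
    (start e.1 ω, fun k => con e.1 k ω, fun k => int e.1 k ω)) P

/-- `H_{i,j}(t)`: equal to `1` if the users `i` and `j` are in contact at time `t`, else `0`. -/
def pairContact {U Ω : Type*} (start : Sym2 U → Ω → Bool) (con int : Sym2 U → ℕ → Ω → ℝ)
    (i j : U) (t : ℝ) (ω : Ω) : ℝ :=
  contactIndicator (start s(i, j) ω) (fun k => con s(i, j) k ω) (fun k => int s(i, j) k ω) t

/-- `H_i^f(t)`: equal to `1` if user `i` is in contact at time `t` with at least one other user
that caches file `f`, else `0`. `x j f = true` means that user `j` caches file `f`. -/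
def fileAvailable {U F Ω : Type*} [Fintype U] [DecidableEq U] (x : U → F → Bool)
    (start : Sym2 U → Ω → Bool) (con int : Sym2 U → ℕ → Ω → ℝ)
    (i : U) (f : F) (t : ℝ) (ω : Ω) : ℝ :=
  1 - ∏ j ∈ Finset.univ.filter (fun j => j ≠ i ∧ x j f = true),
    (1 - pairContact start con int i j t ω)

/-- The time, within the window `[r, r + Td]` after a request at time `r`, during which user `i` can
download file `f` from other users. -/
def windowTime {U F Ω : Type*} [Fintype U] [DecidableEq U] (x : U → F → Bool)
    (start : Sym2 U → Ω → Bool) (con int : Sym2 U → ℕ → Ω → ℝ)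
    (i : U) (f : F) (Td r : ℝ) (ω : Ω) : ℝ :=
  ∫ t in r..(r + Td), fileAvailable x start con int i f t ω

/-- `Tc` (on a probability space of its own) is a communication time of user `i` for file `f` with
delay threshold `Td`: it is the limit in distribution, as the request time tends to infinity, of
the time available for downloading within the window of length `Td`. -/
def IsCommunicationTime {U F Ω Ω' : Type*} [Fintype U] [DecidableEq U] [MeasurableSpace Ω]
    [MeasurableSpace Ω'] (x : U → F → Bool)
    (start : Sym2 U → Ω → Bool) (con int : Sym2 U → ℕ → Ω → ℝ)
    (P : Measure Ω) [IsProbabilityMeasure P] (i : U) (f : F) (Td : ℝ)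
    (Tc : Ω' → ℝ) (Q : Measure Ω') [IsProbabilityMeasure Q] : Prop :=
  TendstoInDistribution (fun (r : ℝ) ω => windowTime x start con int i f Td r ω) atTop Tc
    (fun _ => P) Q

/-- `n_f`, the number of users caching file `f`. -/
def cachingCount {U F : Type*} [Fintype U] (x : U → F → Bool) (f : F) : ℕ :=
  ∑ j, (x j f).toNat

end

end D2D

/-!
Let `q = lC / (lC + lI)` and `p = lI / (lC + lI)`.

A single pair is described by its initial state and the sequence of its phase lengths. Since the
phases are exponential, an observer who arrives at time `r` during the `n`-th phase sees a process
that starts afresh in the state of that phase (`phaseLaw_inPhase_inter_residual`, by induction on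
`n`: peeling off the first phase reduces to the memoryless property). Summing over `n`, the path
seen from time `r` on has the original law, except that the law of the initial state is replaced by
the law of the state at time `r` (`pathLaw_map_restart`). This is the Markov property; it yields the
Chapman-Kolmogorov equation, and, with elementary bounds on the probability of a change of state in
a short time, the forward equation for the probability of contact, which therefore converges to `p`
exponentially fast (`contactProb_formula`).

For the pairs formed by `i` and the users caching `f`, the joint law of the paths seen from time `r`
on is a finite mixture, over the vectors of states at time `r`, of laws that do not depend on `r`.
The weights converge to those of the stationary law, and so the law of the window time converges
(`map_coverTime`, `tendsto_integral_pi_pathLaw`), the limit being the law of the covered time of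
`n` independent stationary pairs in `[0, Td]`. Limits in distribution are unique, so it suffices to
compute the moments of this law. The complementary time is `∫ Z(t) dt`, where `Z(t)` indicates that
no pair is in contact; by Fubini its moments follow from `E[Z(t)] = q ^ n` and
`E[Z(s) Z(t)] = (q * (q + p * exp (-(lC + lI) * |t - s|))) ^ n`. The binomial expansion of the
latter and the integral of `exp (-a * |t - s|)` over a square give the variance
(`variance_coverTime`).
-/

open MeasureTheory ProbabilityTheory Filter

open scoped Topology

namespace D2D

/-! ### Phases of an alternating renewal process -/

/-- The sequence with first term `u`, followed by the terms of `ℓ`. -/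
def consSeq (u : ℝ) (ℓ : ℕ → ℝ) (n : ℕ) : ℝ := Nat.casesOn n u ℓ

@[simp] lemma consSeq_zero (u : ℝ) (ℓ : ℕ → ℝ) : consSeq u ℓ 0 = u := rfl

@[simp] lemma consSeq_succ (u : ℝ) (ℓ : ℕ → ℝ) (n : ℕ) : consSeq u ℓ (n + 1) = ℓ n := rfl

lemma measurable_consSeq : Measurable fun p : ℝ × (ℕ → ℝ) => consSeq p.1 p.2 := by
  refine measurable_pi_lambda _ fun n => ?_
  cases n with
  | zero => exact measurable_fst
  | succ n => exact (measurable_pi_apply n).comp measurable_snd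

@[simp] lemma phaseState_zero (s : Bool) : phaseState s 0 = s := rfl

lemma phaseState_succ (s : Bool) (n : ℕ) : phaseState s (n + 1) = phaseState (!s) n := by
  unfold phaseState
  rcases Nat.mod_two_eq_zero_or_one n with h | h
  · have : (n + 1) % 2 = 1 := by omega
    simp [h, this]
  · have : (n + 1) % 2 = 0 := by omega
    simp [h, this]

lemma phaseState_add (s : Bool) (m n : ℕ) :
    phaseState s (m + n) = phaseState (phaseState s m) n := by
  induction m generalizing s with
  | zero => simp
  | succ m ih => rw [Nat.add_right_comm, phaseState_succ, ih, phaseState_succ]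

/-- The epoch at which the `n`-th phase begins, for phases of lengths `ℓ 0, ℓ 1, …`. -/
def epoch (ℓ : ℕ → ℝ) (n : ℕ) : ℝ := ∑ m ∈ Finset.range n, ℓ m

@[simp] lemma epoch_zero (ℓ : ℕ → ℝ) : epoch ℓ 0 = 0 := rfl

lemma epoch_succ (ℓ : ℕ → ℝ) (n : ℕ) : epoch ℓ (n + 1) = epoch ℓ n + ℓ n :=
  Finset.sum_range_succ _ _

lemma epoch_consSeq_succ (u : ℝ) (ℓ : ℕ → ℝ) (n : ℕ) :
    epoch (consSeq u ℓ) (n + 1) = u + epoch ℓ n := by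
  simp [epoch, Finset.sum_range_succ', add_comm]

lemma measurable_epoch (n : ℕ) : Measurable fun ℓ : ℕ → ℝ => epoch ℓ n := by
  unfold epoch; fun_prop

lemma epoch_mono {ℓ : ℕ → ℝ} (h : ∀ n, 0 < ℓ n) : Monotone (epoch ℓ) :=
  monotone_nat_of_le_succ fun n => by rw [epoch_succ]; linarith [h n]

/-- The phase lengths seen by an observer who arrives at time `r`, during the `n`-th phase: the
residual length of that phase, then the lengths of the following ones. -/
def residual (r : ℝ) (n : ℕ) (ℓ : ℕ → ℝ) : ℕ → ℝ :=
  consSeq (epoch ℓ (n + 1) - r) fun k => ℓ (n + 1 + k)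

lemma measurable_residual (r : ℝ) (n : ℕ) : Measurable (residual r n) :=
  measurable_consSeq.comp (f := fun ℓ : ℕ → ℝ => (epoch ℓ (n + 1) - r, fun k => ℓ (n + 1 + k)))
    (((measurable_epoch _).sub_const r).prodMk (by fun_prop))

lemma residual_zero_consSeq (r u : ℝ) (ℓ : ℕ → ℝ) :
    residual r 0 (consSeq u ℓ) = consSeq (u - r) ℓ := by
  funext k
  cases k with
  | zero => simp [residual, epoch]
  | succ k => simp [residual, add_comm 1 k]

lemma residual_succ_consSeq (r u : ℝ) (n : ℕ) (ℓ : ℕ → ℝ) :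
    residual r (n + 1) (consSeq u ℓ) = residual (r - u) n ℓ := by
  funext k
  cases k with
  | zero => simp only [residual, consSeq_zero, epoch_consSeq_succ]; ring
  | succ k =>
    simp only [residual, consSeq_succ]
    rw [show n + 1 + 1 + k = (n + 1 + k) + 1 by ring, consSeq_succ]

lemma epoch_residual_succ (r : ℝ) (n k : ℕ) (ℓ : ℕ → ℝ) :
    epoch (residual r n ℓ) (k + 1) = epoch ℓ (n + k + 1) - r := by
  unfold residual
  rw [epoch_consSeq_succ, show n + k + 1 = n + 1 + k by ring, epoch, epoch, epoch,
    Finset.sum_range_add ℓ (n + 1) k]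
  ring

/-- The law of the phase lengths of an alternating renewal process started in state `s`, when the
phases in state `a` have law `μ a` and all phases are independent. -/
noncomputable def phaseLaw (μ : Bool → Measure ℝ) [∀ a, IsProbabilityMeasure (μ a)] (s : Bool) :
    Measure (ℕ → ℝ) :=
  Measure.infinitePi fun n => μ (phaseState s n)

/-- A law on the positive reals with unbounded support and the memoryless property. -/
structure IsMemoryless (μ : Measure ℝ) : Prop where
  pos : ∀ᵐ u ∂μ, 0 < u
  tail_ne_zero : ∀ r, μ (Set.Ioi r) ≠ 0
  shift : ∀ r, 0 ≤ r → ∀ A, MeasurableSet A → μ {u | r < u ∧ u - r ∈ A} = μ (Set.Ioi r) * μ A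

/-! ### Memorylessness of the phase lengths -/

section Restart

variable (μ : Bool → Measure ℝ) [∀ a, IsProbabilityMeasure (μ a)]

instance (s : Bool) : IsProbabilityMeasure (phaseLaw μ s) := by
  unfold phaseLaw; infer_instance

/-- First-phase decomposition: after the first phase the process starts afresh in the other
state. -/
lemma phaseLaw_eq_map_consSeq (s : Bool) :
    phaseLaw μ s = ((μ s).prod (phaseLaw μ (!s))).map fun p => consSeq p.1 p.2 := by
  symm
  refine Measure.eq_infinitePi _ fun F t ht => ?_
  obtain ⟨m, hm⟩ := F.exists_nat_subset_range
  classical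
  set t' : ℕ → Set ℝ := fun n => if n ∈ F then t n else Set.univ with ht'
  have ht'm : ∀ n, MeasurableSet (t' n) := fun n => by
    simp only [ht']; split_ifs with h
    exacts [ht n, MeasurableSet.univ]
  have hset : Set.pi (F : Set ℕ) t = Set.pi (Finset.range (m + 1) : Set ℕ) t' := by
    ext ℓ
    simp only [Set.mem_pi, Finset.mem_coe, Finset.mem_range, ht']
    refine ⟨fun h n _ => ?_, fun h n hn => ?_⟩
    · split_ifs with hn
      exacts [h n hn, trivial]
    · have := h n (by have := Finset.mem_range.1 (hm hn); omega)
      rwa [if_pos hn] at this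
  have hprod : ∏ n ∈ F, μ (phaseState s n) (t n)
      = ∏ n ∈ Finset.range (m + 1), μ (phaseState s n) (t' n) := by
    rw [← Finset.prod_subset (hm.trans (Finset.range_mono (Nat.le_succ m)))]
    · exact Finset.prod_congr rfl fun n hn => by simp [ht', hn]
    · intro n _ hn; simp [ht', hn]
  rw [hset, hprod, Measure.map_apply measurable_consSeq
    (MeasurableSet.pi (Finset.countable_toSet _) fun n _ => ht'm n)]
  have hpre : (fun p : ℝ × (ℕ → ℝ) => consSeq p.1 p.2) ⁻¹'
      Set.pi (Finset.range (m + 1) : Set ℕ) t'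
      = t' 0 ×ˢ Set.pi (Finset.range m : Set ℕ) fun n => t' (n + 1) := by
    ext ⟨u, ℓ⟩
    simp only [Set.mem_preimage, Set.mem_pi, Finset.mem_coe, Finset.mem_range, Set.mem_prod]
    refine ⟨fun h => ⟨h 0 (Nat.succ_pos m), fun n hn => h (n + 1) (by omega)⟩, fun h n hn => ?_⟩
    cases n with
    | zero => exact h.1
    | succ n => exact h.2 n (by omega)
  rw [hpre, Measure.prod_prod, phaseLaw, Measure.infinitePi_pi _ fun n _ => ht'm (n + 1),
    Finset.prod_range_succ', mul_comm]
  simp [phaseState_succ]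

lemma phaseLaw_apply (s : Bool) {B : Set (ℕ → ℝ)} (hB : MeasurableSet B) :
    phaseLaw μ s B = ∫⁻ u, phaseLaw μ (!s) {ℓ | consSeq u ℓ ∈ B} ∂(μ s) := by
  rw [phaseLaw_eq_map_consSeq, Measure.map_apply measurable_consSeq hB,
    Measure.prod_apply (measurable_consSeq hB)]
  rfl

/-- The set of phase lengths for which time `r` falls in the `n`-th phase. -/
def inPhase (r : ℝ) (n : ℕ) : Set (ℕ → ℝ) := {ℓ | epoch ℓ n ≤ r ∧ r < epoch ℓ (n + 1)}

lemma measurableSet_inPhase (r : ℝ) (n : ℕ) : MeasurableSet (inPhase r n) :=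
  (measurableSet_le (measurable_epoch n) measurable_const).inter
    (measurableSet_lt measurable_const (measurable_epoch (n + 1)))

variable {μ} (hμ : ∀ a, IsMemoryless (μ a))
include hμ

/-- Given that time `r` falls in the `n`-th phase, the phase lengths seen from time `r` on have the
law of a process started afresh in the state of that phase. -/
lemma phaseLaw_inPhase_inter_residual (n : ℕ) (s : Bool) (r : ℝ) {A : Set (ℕ → ℝ)}
    (hA : MeasurableSet A) :
    phaseLaw μ s (inPhase r n ∩ residual r n ⁻¹' A)
      = phaseLaw μ s (inPhase r n) * phaseLaw μ (phaseState s n) A := by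
  induction n generalizing s r with
  | zero =>
    rcases lt_or_ge r 0 with hr | hr
    · have : inPhase r 0 = ∅ := by
        ext ℓ; simp [inPhase, hr]
      simp [this]
    -- Here the memoryless property of the first phase applies, the later phases being held fixed.
    have h1 : phaseLaw μ s (inPhase r 0) = μ s (Set.Ioi r) := by
      rw [phaseLaw_apply μ s (measurableSet_inPhase r 0)]
      have : ∀ u, phaseLaw μ (!s) {ℓ | consSeq u ℓ ∈ inPhase r 0}
          = (Set.Ioi r).indicator 1 u := fun u => by
        by_cases hu : r < u <;> simp [inPhase, epoch_consSeq_succ, hr, hu]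
      simp_rw [this]
      exact lintegral_indicator_one measurableSet_Ioi
    have hS : MeasurableSet {p : ℝ × (ℕ → ℝ) | r < p.1 ∧ consSeq (p.1 - r) p.2 ∈ A} := by
      refine (measurableSet_lt measurable_const measurable_fst).inter ?_
      exact (measurable_consSeq.comp
        ((measurable_fst.sub_const r).prodMk measurable_snd)) hA
    rw [h1, phaseState_zero, phaseLaw_eq_map_consSeq μ s, Measure.map_apply measurable_consSeq hA,
      Measure.map_apply measurable_consSeq
        ((measurableSet_inPhase r 0).inter (measurable_residual r 0 hA))]
    have hpre : (fun p : ℝ × (ℕ → ℝ) => consSeq p.1 p.2) ⁻¹' (inPhase r 0 ∩ residual r 0 ⁻¹' A)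
        = {p : ℝ × (ℕ → ℝ) | r < p.1 ∧ consSeq (p.1 - r) p.2 ∈ A} := by
      ext ⟨u, ℓ⟩
      simp [inPhase, epoch_consSeq_succ, residual_zero_consSeq, hr]
    rw [hpre, Measure.prod_apply_symm hS, Measure.prod_apply_symm (measurable_consSeq hA),
      ← lintegral_const_mul _ (measurable_measure_prodMk_right (measurable_consSeq hA))]
    refine lintegral_congr fun ℓ => ?_
    exact (hμ s).shift r hr {u | consSeq u ℓ ∈ A}
      (measurable_consSeq.comp (measurable_id.prodMk measurable_const) hA)
  | succ n ih =>
    -- Conditionally on the first phase having length `u`, time `r` becomes time `r - u` of the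
    -- process that begins after it; `r - u` may be negative, so the claim is made for all real `r`.
    rw [phaseLaw_apply μ s ((measurableSet_inPhase r (n + 1)).inter (measurable_residual r _ hA)),
      phaseLaw_apply μ s (measurableSet_inPhase r (n + 1)), ← lintegral_mul_const]
    · refine lintegral_congr fun u => ?_
      have e1 : {ℓ | consSeq u ℓ ∈ inPhase r (n + 1) ∩ residual r (n + 1) ⁻¹' A}
          = inPhase (r - u) n ∩ residual (r - u) n ⁻¹' A := by
        ext ℓ
        simp only [inPhase, Set.mem_inter_iff, Set.mem_ofPred_eq, Set.mem_preimage,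
          epoch_consSeq_succ, residual_succ_consSeq, le_sub_iff_add_le', sub_lt_iff_lt_add']
      have e2 : {ℓ | consSeq u ℓ ∈ inPhase r (n + 1)} = inPhase (r - u) n := by
        ext ℓ
        simp only [inPhase, Set.mem_ofPred_eq, epoch_consSeq_succ, le_sub_iff_add_le',
          sub_lt_iff_lt_add']
      rw [e1, e2, ih, phaseState_succ]
    · exact measurable_measure_prodMk_left
        (measurable_consSeq (measurableSet_inPhase r (n + 1)))

lemma ae_phaseLaw_pos (s : Bool) : ∀ᵐ ℓ ∂(phaseLaw μ s), ∀ n, 0 < ℓ n := by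
  refine ae_all_iff.2 fun n => ?_
  have h := measurePreserving_eval_infinitePi (fun n => μ (phaseState s n)) n
  exact h.quasiMeasurePreserving.ae (hμ _).pos

/-- Infinitely many phases do not fit in a bounded time: otherwise all their lengths would be
bounded by the same number, which has probability zero. -/
lemma ae_phaseLaw_exists_lt_epoch (s : Bool) (r : ℝ) :
    ∀ᵐ ℓ ∂(phaseLaw μ s), ∃ n, r < epoch ℓ (n + 1) := by
  set q : ENNReal := max (μ true (Set.Iic r)) (μ false (Set.Iic r)) with hq
  have hlt : ∀ a, μ a (Set.Iic r) < 1 := fun a => by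
    rw [← not_le]
    intro h
    refine (hμ a).tail_ne_zero r ?_
    rw [← Set.compl_Iic, prob_compl_eq_zero_iff measurableSet_Iic]
    exact le_antisymm prob_le_one h
  have hq1 : q < 1 := max_lt (hlt _) (hlt _)
  have hle : ∀ n : ℕ, phaseLaw μ s {ℓ | ∀ m, ℓ m ≤ r} ≤ q ^ n := fun n => by
    calc phaseLaw μ s {ℓ | ∀ m, ℓ m ≤ r}
        ≤ phaseLaw μ s (Set.pi (Finset.range n : Set ℕ) fun _ => Set.Iic r) :=
          measure_mono fun ℓ hℓ m _ => hℓ m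
      _ = ∏ m ∈ Finset.range n, μ (phaseState s m) (Set.Iic r) :=
          Measure.infinitePi_pi _ fun _ _ => measurableSet_Iic
      _ ≤ ∏ _m ∈ Finset.range n, q := Finset.prod_le_prod' fun m _ => by
          cases phaseState s m
          exacts [le_max_right _ _, le_max_left _ _]
      _ = q ^ n := by simp
  have h0 : phaseLaw μ s {ℓ | ∀ m, ℓ m ≤ r} = 0 :=
    le_antisymm (ge_of_tendsto' (ENNReal.tendsto_pow_atTop_nhds_zero_of_lt_one hq1) hle) bot_le
  have h1 : ∀ᵐ ℓ ∂(phaseLaw μ s), ¬ ∀ m, ℓ m ≤ r := by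
    rw [ae_iff]; simpa using h0
  filter_upwards [h1, ae_phaseLaw_pos hμ s] with ℓ hℓ hpos
  by_contra! h
  refine hℓ fun m => ?_
  have h2 := h m
  have h3 : 0 ≤ epoch ℓ m := Finset.sum_nonneg fun k _ => (hpos k).le
  rw [epoch_succ] at h2
  linarith

end Restart

/-! ### Restarting a path at a given time -/

open Classical in
/-- The contact indicator at time `t` for the path `y` that starts in state `y.1` and has phase
lengths `y.2`. -/
noncomputable def contactAt (y : Bool × (ℕ → ℝ)) (t : ℝ) : ℝ :=
  if ∃ n, phaseState y.1 n = true ∧ epoch y.2 n ≤ t ∧ t < epoch y.2 (n + 1) then 1 else 0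

lemma contactAt_eq_zero_or_one (y : Bool × (ℕ → ℝ)) (t : ℝ) :
    contactAt y t = 0 ∨ contactAt y t = 1 := by
  unfold contactAt; split_ifs <;> simp

lemma measurable_contactAt :
    Measurable fun p : (Bool × (ℕ → ℝ)) × ℝ => contactAt p.1 p.2 := by
  refine Measurable.ite ?_ measurable_const measurable_const
  have hset : {p : (Bool × (ℕ → ℝ)) × ℝ | ∃ n, phaseState p.1.1 n = true ∧ epoch p.1.2 n ≤ p.2 ∧
      p.2 < epoch p.1.2 (n + 1)} = ⋃ n, {p | phaseState p.1.1 n = true ∧ epoch p.1.2 n ≤ p.2 ∧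
      p.2 < epoch p.1.2 (n + 1)} := by
    ext p; simp
  rw [hset]
  refine MeasurableSet.iUnion fun n => ?_
  have hs : Measurable fun p : (Bool × (ℕ → ℝ)) × ℝ => phaseState p.1.1 n :=
    (measurable_of_finite fun s => phaseState s n).comp (measurable_fst.comp measurable_fst)
  have he : ∀ k, Measurable fun p : (Bool × (ℕ → ℝ)) × ℝ => epoch p.1.2 k := fun k =>
    (measurable_epoch k).comp (measurable_snd.comp measurable_fst)
  exact (hs (measurableSet_singleton true)).inter
    ((measurableSet_le (he n) measurable_snd).inter (measurableSet_lt measurable_snd (he _)))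

/-- All phases have positive length, and only finitely many of them begin in any bounded time. -/
def IsRegular (ℓ : ℕ → ℝ) : Prop := (∀ n, 0 < ℓ n) ∧ ∀ r, ∃ n, r < epoch ℓ (n + 1)

/-- The index of the phase in progress at time `r` (`0` if there is none). -/
noncomputable def phaseIndex (r : ℝ) (ℓ : ℕ → ℝ) : ℕ := sInf {n | r < epoch ℓ (n + 1)}

lemma measurable_phaseIndex (r : ℝ) : Measurable (phaseIndex r) := by
  refine measurable_of_Iic fun n => ?_
  have h : phaseIndex r ⁻¹' Set.Iic n = (⋃ m ∈ Finset.range (n + 1), {ℓ | r < epoch ℓ (m + 1)}) ∪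
      ⋂ m, {ℓ | r < epoch ℓ (m + 1)}ᶜ := by
    ext ℓ
    simp only [phaseIndex, Set.mem_preimage, Set.mem_Iic, Set.mem_union, Set.mem_iUnion,
      Set.mem_iInter, Set.mem_compl_iff, Set.mem_ofPred_eq, Finset.mem_range, exists_prop]
    constructor
    · intro h
      by_cases hne : ∃ m, r < epoch ℓ (m + 1)
      · exact Or.inl ⟨_, Nat.lt_succ_of_le h, Nat.sInf_mem (s := {n | r < epoch ℓ (n + 1)}) hne⟩
      · exact Or.inr (not_exists.1 hne)
    · rintro (⟨m, hm, h⟩ | h)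
      · exact (Nat.sInf_le h).trans (Nat.le_of_lt_succ hm)
      · have : {n | r < epoch ℓ (n + 1)} = ∅ := Set.eq_empty_of_forall_notMem h
        simp [this]
  have hm : ∀ m, MeasurableSet {ℓ : ℕ → ℝ | r < epoch ℓ (m + 1)} := fun m =>
    measurableSet_lt measurable_const (measurable_epoch _)
  rw [h]
  exact (MeasurableSet.biUnion (Finset.countable_toSet _) fun m _ => hm m).union
    (MeasurableSet.iInter fun m => (hm m).compl)

lemma mem_inPhase_phaseIndex {r : ℝ} (hr : 0 ≤ r) {ℓ : ℕ → ℝ} (hℓ : IsRegular ℓ) :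
    ℓ ∈ inPhase r (phaseIndex r ℓ) := by
  have hmem : r < epoch ℓ (phaseIndex r ℓ + 1) :=
    Nat.sInf_mem (s := {n | r < epoch ℓ (n + 1)}) (hℓ.2 r)
  refine ⟨?_, hmem⟩
  cases hk : phaseIndex r ℓ with
  | zero => simpa using hr
  | succ k =>
    have : k ∉ {n | r < epoch ℓ (n + 1)} := Nat.notMem_of_lt_sInf (by
      change k < phaseIndex r ℓ; omega)
    simpa using this

lemma phaseIndex_eq {r : ℝ} {n : ℕ} {ℓ : ℕ → ℝ} (hℓ : IsRegular ℓ) (h : ℓ ∈ inPhase r n) :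
    phaseIndex r ℓ = n := by
  refine le_antisymm (Nat.sInf_le h.2) ?_
  by_contra! hlt
  have hmem : r < epoch ℓ (phaseIndex r ℓ + 1) :=
    Nat.sInf_mem (s := {n | r < epoch ℓ (n + 1)}) (hℓ.2 r)
  have := epoch_mono hℓ.1 (Nat.succ_le_of_lt hlt)
  exact absurd (hmem.trans_le this) (not_lt.2 h.1)

/-- The path seen by an observer who arrives at time `r`. -/
noncomputable def restart (r : ℝ) (y : Bool × (ℕ → ℝ)) : Bool × (ℕ → ℝ) :=
  (phaseState y.1 (phaseIndex r y.2), residual r (phaseIndex r y.2) y.2)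

lemma measurable_restart (r : ℝ) : Measurable (restart r) := by
  have h1 : Measurable fun p : ℕ × (Bool × (ℕ → ℝ)) =>
      (phaseState p.2.1 p.1, residual r p.1 p.2.2) :=
    measurable_from_prod_countable_right fun n =>
      ((measurable_of_finite fun s => phaseState s n).comp measurable_fst).prodMk
        ((measurable_residual r n).comp measurable_snd)
  exact h1.comp (((measurable_phaseIndex r).comp measurable_snd).prodMk measurable_id)

/-- At time `r` in the `n`-th phase, contact is decided by the state of that phase alone. -/
lemma contactAt_of_mem_inPhase {s : Bool} {ℓ : ℕ → ℝ} (hℓ : ∀ n, 0 < ℓ n) {r : ℝ} {n : ℕ}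
    (h : ℓ ∈ inPhase r n) : contactAt (s, ℓ) r = if phaseState s n = true then 1 else 0 := by
  unfold contactAt
  congr 1
  refine propext ⟨?_, fun hn => ⟨n, hn, h.1, h.2⟩⟩
  rintro ⟨m, hm, h1, h2⟩
  have hmono := epoch_mono hℓ
  have : m = n := by
    rcases lt_trichotomy m n with hlt | heq | hlt
    · exact absurd (h2.trans_le (hmono (Nat.succ_le_of_lt hlt))) (not_lt.2 h.1)
    · exact heq
    · exact absurd (h.2.trans_le (hmono (Nat.succ_le_of_lt hlt))) (not_lt.2 h1)
  rwa [← this]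

lemma contactAt_add {s : Bool} {ℓ : ℕ → ℝ} (hℓ : ∀ n, 0 < ℓ n) {r : ℝ} {n : ℕ}
    (h : ℓ ∈ inPhase r n) {t : ℝ} (ht : 0 ≤ t) :
    contactAt (s, ℓ) (r + t) = contactAt (phaseState s n, residual r n ℓ) t := by
  unfold contactAt
  congr 1
  have hmono := epoch_mono hℓ
  refine propext ⟨?_, ?_⟩
  · rintro ⟨m, hm, h1, h2⟩
    have hnm : n ≤ m := by
      by_contra! hlt
      have := h2.trans_le ((hmono (Nat.succ_le_of_lt hlt)).trans h.1)
      linarith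
    obtain ⟨k, rfl⟩ := Nat.exists_eq_add_of_le hnm
    refine ⟨k, by simpa [phaseState_add] using hm, ?_, ?_⟩
    · cases k with
      | zero => simpa using ht
      | succ k =>
        simp only [epoch_residual_succ]
        simp only [← add_assoc] at h1
        linarith
    · simp only [epoch_residual_succ]
      linarith
  · rintro ⟨k, hk, h1, h2⟩
    refine ⟨n + k, by simpa [phaseState_add] using hk, ?_, ?_⟩
    · cases k with
      | zero => have := h.1; simp only [add_zero]; linarith
      | succ k =>
        simp only [epoch_residual_succ] at h1
        simp only [← add_assoc]
        linarith
    · simp only [epoch_residual_succ] at h2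
      simp only
      linarith

lemma contactAt_eq_restart {y : Bool × (ℕ → ℝ)} (hy : IsRegular y.2) {r : ℝ} (hr : 0 ≤ r) :
    contactAt y r = if (restart r y).1 = true then 1 else 0 :=
  contactAt_of_mem_inPhase hy.1 (mem_inPhase_phaseIndex hr hy)

/-- Seen from time `r` on, the contact process is that of the restarted path. -/
lemma contactAt_add_eq_restart {y : Bool × (ℕ → ℝ)} (hy : IsRegular y.2) {r t : ℝ} (hr : 0 ≤ r)
    (ht : 0 ≤ t) : contactAt y (r + t) = contactAt (restart r y) t :=
  contactAt_add hy.1 (mem_inPhase_phaseIndex hr hy) ht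

section PathLaw

variable (μ : Bool → Measure ℝ) [∀ a, IsProbabilityMeasure (μ a)]

/-- The law of the path of an alternating renewal process whose initial state has law `β` and is
independent of the lengths of the phases. -/
noncomputable def pathLaw (β : Measure Bool) : Measure (Bool × (ℕ → ℝ)) :=
  ∑ a, β {a} • (phaseLaw μ a).map (Prod.mk a)

lemma pathLaw_apply (β : Measure Bool) {B : Set (Bool × (ℕ → ℝ))} (hB : MeasurableSet B) :
    pathLaw μ β B = ∑ a, β {a} * phaseLaw μ a (Prod.mk a ⁻¹' B) := by
  simp [pathLaw, Measure.map_apply measurable_prodMk_left hB]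

instance (β : Measure Bool) [IsProbabilityMeasure β] : IsProbabilityMeasure (pathLaw μ β) := by
  constructor
  rw [pathLaw_apply μ β MeasurableSet.univ]
  simp only [Set.preimage_univ, measure_univ, mul_one]
  rw [sum_measure_singleton, Finset.coe_univ, measure_univ]

lemma pathLaw_dirac (a : Bool) :
    pathLaw μ (Measure.dirac a) = (phaseLaw μ a).map (Prod.mk a) := by
  cases a <;> simp [pathLaw]

variable {μ} (hμ : ∀ a, IsMemoryless (μ a))
include hμ

lemma ae_isRegular_phaseLaw (s : Bool) : ∀ᵐ ℓ ∂(phaseLaw μ s), IsRegular ℓ := by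
  have h : ∀ᵐ ℓ ∂(phaseLaw μ s), ∀ k : ℕ, ∃ n, (k : ℝ) < epoch ℓ (n + 1) :=
    ae_all_iff.2 fun k => ae_phaseLaw_exists_lt_epoch hμ s k
  filter_upwards [h, ae_phaseLaw_pos hμ s] with ℓ h1 h2
  refine ⟨h2, fun r => ?_⟩
  obtain ⟨k, hk⟩ := exists_nat_gt r
  obtain ⟨n, hn⟩ := h1 k
  exact ⟨n, hk.trans hn⟩

lemma ae_isRegular_pathLaw (β : Measure Bool) : ∀ᵐ y ∂(pathLaw μ β), IsRegular y.2 := by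
  have h : ∀ a, ∀ᵐ y ∂((phaseLaw μ a).map (Prod.mk a)), IsRegular y.2 := fun a =>
    (measurableEmbedding_prodMk_left a).ae_map_iff.2 (ae_isRegular_phaseLaw hμ a)
  rw [pathLaw, Fintype.sum_bool, ae_add_measure_iff]
  exact ⟨Measure.ae_smul_measure (h true) _, Measure.ae_smul_measure (h false) _⟩

/-- The path seen from time `r` on is again an alternating renewal process with the same laws of
the phases; only the law of its initial state depends on `r`. -/
lemma pathLaw_map_restart (β : Measure Bool) {r : ℝ} (hr : 0 ≤ r) :
    (pathLaw μ β).map (restart r)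
      = pathLaw μ ((pathLaw μ β).map fun y => (restart r y).1) := by
  -- Decomposition of the law of the restarted path by the index of the phase at time `r`.
  have key : ∀ (s : Bool) {B : Set (Bool × (ℕ → ℝ))}, MeasurableSet B →
      phaseLaw μ s {ℓ | restart r (s, ℓ) ∈ B} = ∑' n, phaseLaw μ s (inPhase r n) *
        phaseLaw μ (phaseState s n) (Prod.mk (phaseState s n) ⁻¹' B) := fun s B hB => by
    have hT : MeasurableSet {ℓ | restart r (s, ℓ) ∈ B} :=
      ((measurable_restart r).comp measurable_prodMk_left) hB
    have hd : Pairwise (Function.onFun (AEDisjoint (phaseLaw μ s))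
        fun n => {ℓ | restart r (s, ℓ) ∈ B} ∩ {ℓ | phaseIndex r ℓ = n}) := fun m n hmn =>
      Disjoint.aedisjoint <| Set.disjoint_left.2 fun ℓ h1 h2 => hmn (h1.2.symm.trans h2.2)
    have hU : {ℓ | restart r (s, ℓ) ∈ B}
        = ⋃ n, {ℓ | restart r (s, ℓ) ∈ B} ∩ {ℓ | phaseIndex r ℓ = n} := by
      ext ℓ; simp
    rw [hU, measure_iUnion₀ hd fun n => (hT.inter
      (measurable_phaseIndex r (measurableSet_singleton n))).nullMeasurableSet]
    refine tsum_congr fun n => ?_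
    rw [← phaseLaw_inPhase_inter_residual hμ n s r (measurable_prodMk_left hB)]
    refine measure_congr ?_
    filter_upwards [ae_isRegular_phaseLaw hμ s] with ℓ hℓ
    refine propext ⟨?_, ?_⟩
    · rintro ⟨h1, h2 : phaseIndex r ℓ = n⟩
      refine ⟨h2 ▸ mem_inPhase_phaseIndex hr hℓ, ?_⟩
      subst h2
      exact h1
    · rintro ⟨h1, h2⟩
      have h3 := phaseIndex_eq hℓ h1
      subst h3
      exact ⟨h2, rfl⟩
  have hfst : Measurable fun y => (restart r y).1 := measurable_fst.comp (measurable_restart r)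
  ext B hB
  rw [Measure.map_apply (measurable_restart r) hB, pathLaw_apply μ _ hB,
    pathLaw_apply μ _ (measurable_restart r hB)]
  have h1 : ∀ b, (pathLaw μ β).map (fun y => (restart r y).1) {b}
      = ∑ a, β {a} * ∑' n, phaseLaw μ a (inPhase r n) * if phaseState a n = b then 1 else 0 := by
    intro b
    rw [Measure.map_apply hfst (measurableSet_singleton b),
      pathLaw_apply μ _ (hfst (measurableSet_singleton b))]
    refine Finset.sum_congr rfl fun a _ => ?_
    congr 1
    refine (key a (measurable_fst (measurableSet_singleton b))).trans (tsum_congr fun n => ?_)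
    congr 1
    split_ifs with h
    · have : Prod.mk (phaseState a n) ⁻¹' (Prod.fst ⁻¹' {b} : Set (Bool × (ℕ → ℝ))) = Set.univ := by
        ext; simp [h]
      rw [this, measure_univ]
    · have : Prod.mk (phaseState a n) ⁻¹' (Prod.fst ⁻¹' {b} : Set (Bool × (ℕ → ℝ))) = ∅ := by
        ext; simp [h]
      rw [this, measure_empty]
  simp_rw [h1, Finset.sum_mul, mul_assoc]
  rw [Finset.sum_comm]
  refine Finset.sum_congr rfl fun a _ => ?_
  rw [← Finset.mul_sum]
  congr 1
  refine (key a hB).trans ?_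
  simp_rw [← ENNReal.tsum_mul_right]
  rw [← Summable.tsum_finsetSum fun _ _ => ENNReal.summable]
  refine tsum_congr fun n => ?_
  cases phaseState a n <;> simp

end PathLaw

/-! ### Exponential phases and the probability of contact -/

lemma expMeasure_real_Ioi {l : ℝ} (hl : 0 < l) {r : ℝ} (hr : 0 ≤ r) :
    (expMeasure l).real (Set.Ioi r) = Real.exp (-(l * r)) := by
  have := isProbabilityMeasure_expMeasure hl
  rw [← Set.compl_Iic, probReal_compl_eq_one_sub measurableSet_Iic, ← cdf_eq_real,
    cdf_expMeasure_eq hl, if_pos hr]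
  ring

lemma expMeasure_real_Iic {l : ℝ} (hl : 0 < l) {r : ℝ} (hr : 0 ≤ r) :
    (expMeasure l).real (Set.Iic r) = 1 - Real.exp (-(l * r)) := by
  have := isProbabilityMeasure_expMeasure hl
  rw [← cdf_eq_real, cdf_expMeasure_eq hl, if_pos hr]

lemma isMemoryless_expMeasure {l : ℝ} (hl : 0 < l) : IsMemoryless (expMeasure l) := by
  have := isProbabilityMeasure_expMeasure hl
  have hIoi : ∀ r, 0 ≤ r → expMeasure l (Set.Ioi r) = ENNReal.ofReal (Real.exp (-(l * r))) :=
    fun r hr => by rw [← expMeasure_real_Ioi hl hr, ofReal_measureReal]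
  refine ⟨?_, fun r h => ?_, fun r hr A hA => ?_⟩
  · have h0 : (expMeasure l).real (Set.Iic 0) = 0 := by simp [expMeasure_real_Iic hl le_rfl]
    rw [measureReal_eq_zero_iff] at h0
    rw [ae_iff]
    convert! h0 using 2
    ext u; simp
  · have h1 : expMeasure l (Set.Ioi (max r 0)) = 0 :=
      measure_mono_null (Set.Ioi_subset_Ioi (le_max_left _ _)) h
    rw [hIoi _ (le_max_right _ _), ENNReal.ofReal_eq_zero] at h1
    exact absurd h1 (not_le.2 (Real.exp_pos _))
  · have hsub : Measurable fun u : ℝ => u - r := by fun_prop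
    have key : ((expMeasure l).restrict (Set.Ioi r)).map (fun u => u - r)
        = ENNReal.ofReal (Real.exp (-(l * r))) • expMeasure l := by
      refine Measure.ext_of_Iic _ _ fun a => ?_
      rw [Measure.map_apply hsub measurableSet_Iic,
        Measure.restrict_apply (hsub measurableSet_Iic)]
      have hset : (fun u : ℝ => u - r) ⁻¹' Set.Iic a ∩ Set.Ioi r = Set.Ioc r (a + r) := by
        ext u; simp [and_comm]
      rw [hset, Measure.smul_apply, smul_eq_mul]
      conv_lhs => rw [← measure_cdf (expMeasure l), StieltjesFunction.measure_Ioc]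
      rw [← ofReal_cdf, ← ENNReal.ofReal_mul (Real.exp_pos _).le, cdf_expMeasure_eq hl,
        cdf_expMeasure_eq hl, cdf_expMeasure_eq hl, if_pos hr]
      rcases lt_or_ge a 0 with ha | ha
      · rw [if_neg (not_le.2 ha), mul_zero, ENNReal.ofReal_zero, ENNReal.ofReal_eq_zero]
        split_ifs with h
        · have : Real.exp (-(l * r)) ≤ Real.exp (-(l * (a + r))) :=
            Real.exp_le_exp.2 (by nlinarith)
          linarith
        · have : Real.exp (-(l * r)) ≤ 1 := Real.exp_le_one_iff.2 (by nlinarith)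
          linarith
      · rw [if_pos ha, if_pos (by linarith)]
        congr 1
        rw [show -(l * (a + r)) = -(l * r) + -(l * a) by ring, Real.exp_add]
        ring
    have h2 := congrArg (fun m : Measure ℝ => m A) key
    simp only [Measure.map_apply hsub hA, Measure.restrict_apply (hsub hA), Measure.smul_apply,
      smul_eq_mul] at h2
    rw [hIoi r hr, ← h2]
    congr 1
    ext u
    simp [and_comm]

section ContactProb

variable (μ : Bool → Measure ℝ) [∀ a, IsProbabilityMeasure (μ a)]

/-- The law of the state at time `r`, when the initial state has law `β`. -/
noncomputable def stateLaw (β : Measure Bool) (r : ℝ) : Measure Bool :=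
  (pathLaw μ β).map fun y => (restart r y).1

lemma measurable_fst_restart (r : ℝ) : Measurable fun y => (restart r y).1 :=
  measurable_fst.comp (measurable_restart r)

instance (β : Measure Bool) [IsProbabilityMeasure β] (r : ℝ) :
    IsProbabilityMeasure (stateLaw μ β r) :=
  Measure.isProbabilityMeasure_map (measurable_fst_restart r).aemeasurable

/-- The probability of contact at time `r`, when the initial state has law `β`. -/
noncomputable def contactProb (β : Measure Bool) (r : ℝ) : ℝ :=
  ∫ y, contactAt y r ∂(pathLaw μ β)

/-- The probability that the state at time `r` is not the initial state `a`. -/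
noncomputable def switchProb (a : Bool) (r : ℝ) : ℝ :=
  (phaseLaw μ a).real {ℓ | phaseState a (phaseIndex r ℓ) = !a}

lemma measurable_contactAt_const (r : ℝ) : Measurable fun y => contactAt y r :=
  measurable_contactAt.comp (measurable_id.prodMk measurable_const)

lemma norm_contactAt_le (y : Bool × (ℕ → ℝ)) (r : ℝ) : ‖contactAt y r‖ ≤ 1 := by
  rcases contactAt_eq_zero_or_one y r with h | h <;> simp [h]

lemma integrable_contactAt (m : Measure (Bool × (ℕ → ℝ))) [IsFiniteMeasure m] (r : ℝ) :
    Integrable (fun y => contactAt y r) m :=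
  Integrable.of_bound (measurable_contactAt_const r).aestronglyMeasurable 1
    (Eventually.of_forall fun y => norm_contactAt_le y r)

lemma real_singleton_false (β : Measure Bool) [IsProbabilityMeasure β] :
    β.real {false} = 1 - β.real {true} := by
  rw [← probReal_compl_eq_one_sub (measurableSet_singleton true)]
  congr 1
  ext a; simp

lemma integral_pathLaw (β : Measure Bool) [IsProbabilityMeasure β] {φ : Bool × (ℕ → ℝ) → ℝ}
    (hφ : ∀ a, Integrable φ (pathLaw μ (Measure.dirac a))) :
    ∫ y, φ y ∂(pathLaw μ β) = β.real {true} * ∫ y, φ y ∂(pathLaw μ (Measure.dirac true))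
      + (1 - β.real {true}) * ∫ y, φ y ∂(pathLaw μ (Measure.dirac false)) := by
  have h : ∀ a, Integrable φ ((phaseLaw μ a).map (Prod.mk a)) := fun a => by
    rw [← pathLaw_dirac]
    exact hφ a
  rw [pathLaw, Fintype.sum_bool, integral_add_measure
    ((h true).smul_measure (measure_ne_top _ _)) ((h false).smul_measure (measure_ne_top _ _)),
    integral_smul_measure, integral_smul_measure, pathLaw_dirac, pathLaw_dirac,
    ← real_singleton_false]
  rfl

variable {μ} (hμ : ∀ a, IsMemoryless (μ a))
include hμ

lemma contactProb_eq (β : Measure Bool) [IsProbabilityMeasure β] {r : ℝ} (hr : 0 ≤ r) :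
    contactProb μ β r = (stateLaw μ β r).real {true} := by
  have hm := measurable_fst_restart r (measurableSet_singleton true)
  rw [stateLaw, map_measureReal_apply (measurable_fst_restart r) (measurableSet_singleton true),
    ← integral_indicator_one hm, contactProb]
  refine integral_congr_ae ?_
  filter_upwards [ae_isRegular_pathLaw hμ β] with y hy
  rw [contactAt_eq_restart hy hr]
  by_cases h : (restart r y).1 = true
  · rw [if_pos h, Set.indicator_of_mem (show y ∈ _ from h), Pi.one_apply]
  · rw [if_neg h, Set.indicator_of_notMem (show y ∉ _ from h)]

/-- The Chapman-Kolmogorov equation for the process restarted at time `r`. -/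
lemma contactProb_add (β : Measure Bool) [IsProbabilityMeasure β] {r t : ℝ} (hr : 0 ≤ r)
    (ht : 0 ≤ t) : contactProb μ β (r + t)
      = contactProb μ β r * contactProb μ (Measure.dirac true) t
        + (1 - contactProb μ β r) * contactProb μ (Measure.dirac false) t := by
  have h1 : contactProb μ β (r + t) = contactProb μ (stateLaw μ β r) t := by
    rw [contactProb, contactProb, stateLaw, ← pathLaw_map_restart hμ β hr,
      integral_map (measurable_restart r).aemeasurable
        (measurable_contactAt_const t).aestronglyMeasurable]
    refine integral_congr_ae ?_
    filter_upwards [ae_isRegular_pathLaw hμ β] with y hy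
    exact contactAt_add_eq_restart hy hr ht
  rw [h1, contactProb, integral_pathLaw μ _ fun a => integrable_contactAt _ t,
    ← contactProb_eq hμ β hr]
  rfl

lemma contactProb_dirac_false {r : ℝ} (hr : 0 ≤ r) :
    contactProb μ (Measure.dirac false) r = switchProb μ false r := by
  rw [contactProb_eq hμ _ hr, stateLaw, pathLaw_dirac,
    map_measureReal_apply (measurable_fst_restart r) (measurableSet_singleton true),
    map_measureReal_apply measurable_prodMk_left
      (measurable_fst_restart r (measurableSet_singleton true))]
  rfl

lemma contactProb_dirac_true {r : ℝ} (hr : 0 ≤ r) :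
    contactProb μ (Measure.dirac true) r = 1 - switchProb μ true r := by
  rw [contactProb_eq hμ _ hr, eq_sub_iff_add_eq', ← eq_sub_iff_add_eq, ← real_singleton_false,
    stateLaw, pathLaw_dirac,
    map_measureReal_apply (measurable_fst_restart r) (measurableSet_singleton false),
    map_measureReal_apply measurable_prodMk_left
      (measurable_fst_restart r (measurableSet_singleton false))]
  rfl

lemma contactProb_zero (β : Measure Bool) [IsProbabilityMeasure β] :
    contactProb μ β 0 = β.real {true} := by
  have h : ∀ a, contactProb μ (Measure.dirac a) 0 = if a = true then 1 else 0 := fun a => by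
    have : ∀ᵐ ℓ ∂(phaseLaw μ a), contactAt (a, ℓ) 0 = if a = true then 1 else 0 := by
      filter_upwards [ae_phaseLaw_pos hμ a] with ℓ hℓ
      have h0 : ℓ ∈ inPhase 0 0 := ⟨le_rfl, by simpa [epoch] using hℓ 0⟩
      exact contactAt_of_mem_inPhase hℓ h0
    rw [contactProb, pathLaw_dirac, integral_map measurable_prodMk_left.aemeasurable
      (measurable_contactAt_const 0).aestronglyMeasurable, integral_congr_ae this]
    simp
  rw [contactProb, integral_pathLaw μ _ fun a => integrable_contactAt _ 0]
  change _ * contactProb μ _ 0 + _ * contactProb μ _ 0 = _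
  simp [h]

lemma contactProb_mem_Icc (β : Measure Bool) [IsProbabilityMeasure β] {r : ℝ} (hr : 0 ≤ r) :
    0 ≤ contactProb μ β r ∧ contactProb μ β r ≤ 1 := by
  rw [contactProb_eq hμ β hr]
  exact ⟨measureReal_nonneg, measureReal_le_one⟩

/-- A switch before time `r` requires the first phase to end by then. -/
lemma switchProb_le (a : Bool) {r : ℝ} (hr : 0 ≤ r) :
    switchProb μ a r ≤ (μ a).real (Set.Iic r) := by
  have h : (μ a).real (Set.Iic r) = (phaseLaw μ a).real {ℓ | ℓ 0 ≤ r} := by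
    have := measurePreserving_eval_infinitePi (fun n => μ (phaseState a n)) 0
    exact (this.measureReal_preimage measurableSet_Iic.nullMeasurableSet).symm
  rw [h, switchProb, measureReal_def, measureReal_def]
  refine ENNReal.toReal_mono (measure_ne_top _ _) (measure_mono_ae ?_)
  filter_upwards [ae_isRegular_phaseLaw hμ a] with ℓ hℓ (h : phaseState a _ = !a)
  by_contra hlt
  have h0 : ℓ ∈ inPhase r 0 := ⟨by simpa using hr, by simpa [epoch] using not_le.1 hlt⟩
  rw [phaseIndex_eq hℓ h0] at h
  cases a <;> simp at h

/-- The state has switched at time `r` if the first phase ends by then and the second one is longer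
than `r`. -/
lemma le_switchProb (a : Bool) (r : ℝ) :
    (μ a).real (Set.Iic r) * (μ (!a)).real (Set.Ioi r) ≤ switchProb μ a r := by
  set t : ℕ → Set ℝ := fun n => if n = 0 then Set.Iic r else Set.Ioi r with ht
  have hbox : (phaseLaw μ a) (Set.pi (Finset.range 2 : Set ℕ) t)
      = μ a (Set.Iic r) * μ (!a) (Set.Ioi r) := by
    rw [phaseLaw, Measure.infinitePi_pi _ fun n _ => by
      simp only [ht]; split_ifs; exacts [measurableSet_Iic, measurableSet_Ioi]]
    simp [Finset.prod_range_succ, ht, phaseState_succ a 0]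
  rw [measureReal_def, measureReal_def, ← ENNReal.toReal_mul, ← hbox, switchProb, measureReal_def]
  refine ENNReal.toReal_mono (measure_ne_top _ _) (measure_mono_ae ?_)
  filter_upwards [ae_isRegular_phaseLaw hμ a] with ℓ hℓ (h : ℓ ∈ Set.pi _ t)
  have h0 : ℓ 0 ≤ r := by simpa [ht] using h 0 (by simp)
  have h1 : r < ℓ 1 := by simpa [ht] using h 1 (by simp)
  have hmem : ℓ ∈ inPhase r 1 := by
    refine ⟨by simpa [epoch] using h0, ?_⟩
    have := hℓ.1 0
    simp only [epoch, Finset.sum_range_succ, Finset.sum_range_zero]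
    linarith
  change phaseState a (phaseIndex r ℓ) = !a
  rw [phaseIndex_eq hℓ hmem, phaseState_succ, phaseState_zero]

end ContactProb

section ExponentialPhases

variable {μ : Bool → Measure ℝ} [∀ a, IsProbabilityMeasure (μ a)] {l : Bool → ℝ}
  (hl : ∀ a, 0 < l a) (hμ : ∀ a, μ a = expMeasure (l a))
include hl hμ

omit [∀ a, IsProbabilityMeasure (μ a)] in
lemma isMemoryless_of_eq_expMeasure (a : Bool) : IsMemoryless (μ a) :=
  hμ a ▸ isMemoryless_expMeasure (hl a)

lemma switchProb_bounds (a : Bool) {r : ℝ} (hr : 0 ≤ r) :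
    (1 - Real.exp (-(l a * r))) * Real.exp (-(l (!a) * r)) ≤ switchProb μ a r ∧
      switchProb μ a r ≤ 1 - Real.exp (-(l a * r)) := by
  have hm := isMemoryless_of_eq_expMeasure hl hμ
  have h1 := le_switchProb hm a r
  have h2 := switchProb_le hm a hr
  rw [hμ, expMeasure_real_Iic (hl a) hr] at h1 h2
  rw [hμ, expMeasure_real_Ioi (hl _) hr] at h1
  exact ⟨h1, h2⟩

lemma switchProb_nonneg_le (a : Bool) {r : ℝ} (hr : 0 ≤ r) :
    0 ≤ switchProb μ a r ∧ switchProb μ a r ≤ l a * r := by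
  refine ⟨measureReal_nonneg, (switchProb_bounds hl hμ a hr).2.trans ?_⟩
  linarith [Real.add_one_le_exp (-(l a * r))]

lemma hasDerivWithinAt_switchProb (a : Bool) :
    HasDerivWithinAt (switchProb μ a) (l a) (Set.Ici 0) 0 := by
  have h0 : switchProb μ a 0 = 0 := by
    have := switchProb_nonneg_le hl hμ a le_rfl
    rw [mul_zero] at this
    exact le_antisymm this.2 this.1
  have he : ∀ c : ℝ, HasDerivAt (fun r : ℝ => Real.exp (-(c * r))) (-c) 0 := fun c => by
    have := ((hasDerivAt_id (0 : ℝ)).const_mul c).neg.exp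
    simpa using this
  have hU : HasDerivAt (fun r : ℝ => 1 - Real.exp (-(l a * r))) (l a) 0 := by
    simpa using (he (l a)).const_sub 1
  have hL : HasDerivAt (fun r : ℝ => (1 - Real.exp (-(l a * r))) * Real.exp (-(l (!a) * r)))
      (l a) 0 := by
    have := hU.mul (he (l (!a)))
    simp only [mul_zero, neg_zero, Real.exp_zero, sub_self, zero_mul, mul_one, add_zero] at this
    exact this
  have hU' := (hasDerivWithinAt_iff_tendsto_slope' (Set.self_notMem_Ioi)).1
    (hU.hasDerivWithinAt (s := Set.Ioi 0))
  have hL' := (hasDerivWithinAt_iff_tendsto_slope' (Set.self_notMem_Ioi)).1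
    (hL.hasDerivWithinAt (s := Set.Ioi 0))
  rw [← hasDerivWithinAt_Ioi_iff_Ici, hasDerivWithinAt_iff_tendsto_slope' Set.self_notMem_Ioi]
  refine tendsto_of_tendsto_of_tendsto_of_le_of_le' hL' hU' ?_ ?_
  all_goals
    filter_upwards [self_mem_nhdsWithin] with r (hr : 0 < r)
    have hb := switchProb_bounds hl hμ a hr.le
    simp only [slope_def_field, h0, mul_zero, neg_zero, Real.exp_zero, sub_self, zero_mul, sub_zero]
    gcongr
  exacts [hb.1, hb.2]

/-- The probability of contact relaxes exponentially fast to its stationary value. It solves the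
forward equation `g' = l₀ (1 - g) - l₁ g`, for the rate `l₀` at which contacts begin and the rate
`l₁` at which they end. -/
lemma contactProb_formula (β : Measure Bool) [IsProbabilityMeasure β] {t : ℝ} (ht : 0 ≤ t) :
    contactProb μ β t = l false / (l true + l false)
      + (β.real {true} - l false / (l true + l false))
        * Real.exp (-((l true + l false) * t)) := by
  have hm := isMemoryless_of_eq_expMeasure hl hμ
  set c := l true + l false with hc
  have hcpos : 0 < c := add_pos (hl _) (hl _)
  set g := contactProb μ β with hg
  have hstep : ∀ r, 0 ≤ r → ∀ x, r ≤ x → g x = g r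
      + ((1 - g r) * switchProb μ false (x - r) - g r * switchProb μ true (x - r)) :=
    fun r hr x hx => by
      have h := contactProb_add hm β hr (sub_nonneg.2 hx)
      rw [add_sub_cancel, contactProb_dirac_true hm (sub_nonneg.2 hx),
        contactProb_dirac_false hm (sub_nonneg.2 hx)] at h
      rw [hg, h]; ring
  have hlip : ∀ r, 0 ≤ r → ∀ x, r ≤ x → |g x - g r| ≤ c * (x - r) := fun r hr x hx => by
    have h01 := contactProb_mem_Icc hm β hr
    rw [← hg] at h01
    have ha := switchProb_nonneg_le hl hμ true (sub_nonneg.2 hx)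
    have hb := switchProb_nonneg_le hl hμ false (sub_nonneg.2 hx)
    have hx' := sub_nonneg.2 hx
    have ha0 := mul_nonneg (hl true).le hx'
    have hb0 := mul_nonneg (hl false).le hx'
    have e1 : (1 - g r) * switchProb μ false (x - r) ≤ 1 * switchProb μ false (x - r) :=
      mul_le_mul_of_nonneg_right (by linarith) hb.1
    have e2 : g r * switchProb μ true (x - r) ≤ 1 * switchProb μ true (x - r) :=
      mul_le_mul_of_nonneg_right (by linarith) ha.1
    have e3 := mul_nonneg (sub_nonneg.2 h01.2) hb.1
    have e4 := mul_nonneg h01.1 ha.1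
    rw [hstep r hr x hx, abs_le]
    constructor <;> rw [hc] <;> linarith
  have hcont : ContinuousOn g (Set.Icc 0 t) := by
    refine (LipschitzOnWith.of_dist_le_mul (K := c.toNNReal) fun x hx y hy => ?_).continuousOn
    rw [Real.dist_eq, Real.dist_eq, Real.coe_toNNReal _ hcpos.le]
    rcases le_total x y with h | h
    · rw [abs_sub_comm, abs_sub_comm x, abs_of_nonneg (sub_nonneg.2 h)]
      exact hlip x hx.1 y h
    · rw [abs_of_nonneg (sub_nonneg.2 h)]
      exact hlip y hy.1 x h
  have hderiv : ∀ r, 0 ≤ r → HasDerivWithinAt g (l false - c * g r) (Set.Ici r) r := fun r hr => by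
    have hs : ∀ a, HasDerivWithinAt (fun x => switchProb μ a (x - r)) (l a) (Set.Ici r) r :=
      fun a => by
        have h1 : HasDerivWithinAt (switchProb μ a) (l a) (Set.Ici 0) (r - r) := by
          rw [sub_self]; exact hasDerivWithinAt_switchProb hl hμ a
        have h2 := h1.comp (h := fun x => x - r) r
          (((hasDerivAt_id r).sub_const r).hasDerivWithinAt (s := Set.Ici r))
          fun x (hx : r ≤ x) => sub_nonneg.2 hx
        rw [mul_one] at h2
        exact h2
    have h3 := (((hs false).const_mul (1 - g r)).sub ((hs true).const_mul (g r))).const_add (g r)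
    refine (h3.congr (fun x hx => hstep r hr x hx) (hstep r hr r le_rfl)).congr_deriv ?_
    rw [hc]; ring
  have hconst := constant_of_has_deriv_right_zero (a := 0) (b := t)
    (f := fun r => (g r - l false / c) * Real.exp (c * r))
    ((hcont.sub continuousOn_const).mul (by fun_prop)) (fun r hr => by
      have he : HasDerivAt (fun r : ℝ => Real.exp (c * r)) (Real.exp (c * r) * c) r := by
        simpa using ((hasDerivAt_id r).const_mul c).exp
      refine (((hderiv r hr.1).sub_const (l false / c)).mul he.hasDerivWithinAt).congr_deriv ?_
      field_simp
      ring) t ⟨ht, le_rfl⟩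
  simp only [mul_zero, Real.exp_zero, mul_one] at hconst
  rw [hg, contactProb_zero hm, ← hg] at hconst
  rw [← hconst, mul_assoc, ← Real.exp_add, add_neg_cancel, Real.exp_zero]
  ring

end ExponentialPhases

/-! ### Independent processes and the covered time -/

lemma measure_bool_ext {β β' : Measure Bool} [IsProbabilityMeasure β] [IsProbabilityMeasure β']
    (h : β.real {true} = β'.real {true}) : β = β' := by
  refine Measure.ext_of_singleton fun a => ?_
  have key : β.real {a} = β'.real {a} := by
    cases a
    · rw [real_singleton_false, real_singleton_false, h]
    · exact h
  rwa [measureReal_def, measureReal_def,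
    ENNReal.toReal_eq_toReal_iff' (measure_ne_top _ _) (measure_ne_top _ _)] at key

lemma exists_isProbabilityMeasure_bool {p : ℝ} (h0 : 0 ≤ p) (h1 : p ≤ 1) :
    ∃ β : Measure Bool, IsProbabilityMeasure β ∧ β.real {true} = p := by
  refine ⟨ENNReal.ofReal p • Measure.dirac true + ENNReal.ofReal (1 - p) • Measure.dirac false,
    ⟨?_⟩, ?_⟩
  · simp [← ENNReal.ofReal_add h0 (sub_nonneg.2 h1)]
  · simp [measureReal_def, h0]

section Product

variable {J : Type*} [Fintype J]

/-- The indicator that none of the processes is in contact at time `t`. -/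
noncomputable def noContactAt (y : J → Bool × (ℕ → ℝ)) (t : ℝ) : ℝ := ∏ j, (1 - contactAt (y j) t)

/-- The time within `[r, r + T]` during which at least one of the processes is in contact. -/
noncomputable def coverTime (T r : ℝ) (y : J → Bool × (ℕ → ℝ)) : ℝ :=
  ∫ t in r..(r + T), (1 - noContactAt y t)

lemma measurable_noContactAt :
    Measurable fun p : (J → Bool × (ℕ → ℝ)) × ℝ => noContactAt p.1 p.2 := by
  refine Finset.measurable_prod _ fun j _ => measurable_const.sub ?_
  exact measurable_contactAt.comp (f := fun p : (J → Bool × (ℕ → ℝ)) × ℝ => (p.1 j, p.2))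
    (((measurable_pi_apply j).comp measurable_fst).prodMk measurable_snd)

lemma noContactAt_mem_Icc (y : J → Bool × (ℕ → ℝ)) (t : ℝ) :
    0 ≤ noContactAt y t ∧ noContactAt y t ≤ 1 := by
  have h : ∀ j, 0 ≤ 1 - contactAt (y j) t ∧ 1 - contactAt (y j) t ≤ 1 := fun j => by
    rcases contactAt_eq_zero_or_one (y j) t with h | h <;> simp [h]
  exact ⟨Finset.prod_nonneg fun j _ => (h j).1, Finset.prod_le_one (fun j _ => (h j).1)
    fun j _ => (h j).2⟩

lemma intervalIntegrable_noContactAt (y : J → Bool × (ℕ → ℝ)) (a b : ℝ) :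
    IntervalIntegrable (noContactAt y) volume a b := by
  have hm : Measurable (noContactAt y) :=
    measurable_noContactAt.comp (measurable_const.prodMk measurable_id)
  refine intervalIntegrable_const (c := (1 : ℝ)) |>.mono_fun hm.aestronglyMeasurable
    (Eventually.of_forall fun t => ?_)
  beta_reduce
  rw [Real.norm_of_nonneg (noContactAt_mem_Icc y t).1]
  simpa using (noContactAt_mem_Icc y t).2

lemma measurable_coverTime (T r : ℝ) : Measurable (coverTime T r : (J → Bool × (ℕ → ℝ)) → ℝ) := by
  have h : StronglyMeasurable (Function.uncurry fun (y : J → Bool × (ℕ → ℝ)) (t : ℝ) =>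
      1 - noContactAt y t) := (measurable_const.sub measurable_noContactAt).stronglyMeasurable
  unfold coverTime intervalIntegral
  exact (h.integral_prod_right (ν := volume.restrict (Set.Ioc r (r + T)))).measurable.sub
    (h.integral_prod_right (ν := volume.restrict (Set.Ioc (r + T) r))).measurable

lemma coverTime_mem_Icc {T : ℝ} (hT : 0 ≤ T) (r : ℝ) (y : J → Bool × (ℕ → ℝ)) :
    0 ≤ coverTime T r y ∧ coverTime T r y ≤ T := by
  have hle : r ≤ r + T := by linarith
  refine ⟨intervalIntegral.integral_nonneg hle fun t _ =>
    sub_nonneg.2 (noContactAt_mem_Icc y t).2, ?_⟩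
  have h := intervalIntegral.integral_mono_on hle
    ((intervalIntegrable_const (c := (1 : ℝ))).sub (intervalIntegrable_noContactAt y r (r + T)))
    (intervalIntegrable_const (c := (1 : ℝ)))
    fun t _ => by linarith [(noContactAt_mem_Icc y t).1]
  simpa [coverTime] using h

variable (μ : Bool → Measure ℝ) [∀ a, IsProbabilityMeasure (μ a)]

/-- Independent paths with random initial states: the joint law is the mixture over all vectors of
initial states. -/
lemma pi_pathLaw [DecidableEq J] (β : J → Measure Bool) [∀ j, IsProbabilityMeasure (β j)] :
    Measure.pi (fun j => pathLaw μ (β j))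
      = ∑ s : J → Bool, (∏ j, β j {s j}) •
          Measure.pi fun j => pathLaw μ (Measure.dirac (s j)) := by
  refine Measure.pi_eq fun A hA => ?_
  have h : ∀ j a, pathLaw μ (Measure.dirac a) (A j) = phaseLaw μ a (Prod.mk a ⁻¹' A j) :=
    fun j a => by rw [pathLaw_dirac, Measure.map_apply measurable_prodMk_left (hA j)]
  have h' : ∀ j, pathLaw μ (β j) (A j)
      = ∑ a, β j {a} * pathLaw μ (Measure.dirac a) (A j) := fun j => by
    rw [pathLaw_apply μ _ (hA j)]
    simp_rw [h]
  simp only [h', Measure.finsetSum_apply, Measure.smul_apply, Measure.pi_pi, smul_eq_mul,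
    ← Finset.prod_mul_distrib]
  rw [Finset.prod_univ_sum, Fintype.piFinset_univ]

/-- The mixture weights are the only part of the joint law that depends on the laws of the initial
states, so convergence of the latter gives convergence of the expectation of every bounded
measurable function, continuous or not. -/
lemma tendsto_integral_pi_pathLaw {ι : Type*} {L : Filter ι} {B : ι → J → Measure Bool}
    {β : J → Measure Bool} [∀ r j, IsProbabilityMeasure (B r j)] [∀ j, IsProbabilityMeasure (β j)]
    (h : ∀ j, Tendsto (fun r => (B r j).real {true}) L (𝓝 ((β j).real {true})))
    {G : (J → Bool × (ℕ → ℝ)) → ℝ} (hG : Measurable G) {C : ℝ} (hC : ∀ y, ‖G y‖ ≤ C) :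
    Tendsto (fun r => ∫ y, G y ∂(Measure.pi fun j => pathLaw μ (B r j))) L
      (𝓝 (∫ y, G y ∂(Measure.pi fun j => pathLaw μ (β j)))) := by
  classical
  have hint : ∀ (m : Measure (J → Bool × (ℕ → ℝ))) [IsFiniteMeasure m], Integrable G m :=
    fun m _ => Integrable.of_bound hG.aestronglyMeasurable C (Eventually.of_forall hC)
  have key : ∀ (γ : J → Measure Bool) [∀ j, IsProbabilityMeasure (γ j)],
      ∫ y, G y ∂(Measure.pi fun j => pathLaw μ (γ j)) = ∑ s : J → Bool, (∏ j, (γ j).real {s j}) *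
        ∫ y, G y ∂(Measure.pi fun j => pathLaw μ (Measure.dirac (s j))) := fun γ _ => by
    rw [pi_pathLaw, integral_finsetSum_measure fun s _ => (hint _).smul_measure
      (ENNReal.prod_ne_top fun j _ => measure_ne_top _ _)]
    refine Finset.sum_congr rfl fun s _ => ?_
    rw [integral_smul_measure, ENNReal.toReal_prod, smul_eq_mul]
    rfl
  rw [key β]
  refine Tendsto.congr (fun r => (key (B r)).symm) ?_
  refine tendsto_finsetSum _ fun s _ => (tendsto_finsetProd _ fun j _ => ?_).mul_const _
  cases s j
  · simp_rw [real_singleton_false]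
    exact (h j).const_sub 1
  · exact h j

variable {μ} (hμ : ∀ a, IsMemoryless (μ a))
include hμ

/-- The law of the time covered in `[r, r + T]` is that of the time covered in `[0, T]` by processes
whose initial states have the laws of the states at time `r`. -/
lemma map_coverTime (β : J → Measure Bool) [∀ j, IsProbabilityMeasure (β j)] {T r : ℝ}
    (hT : 0 ≤ T) (hr : 0 ≤ r) :
    (Measure.pi fun j => pathLaw μ (β j)).map (coverTime T r)
      = (Measure.pi fun j => pathLaw μ (stateLaw μ (β j) r)).map (coverTime T 0) := by
  have hR : ∀ j, pathLaw μ (stateLaw μ (β j) r) = (pathLaw μ (β j)).map (restart r) := fun j =>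
    (pathLaw_map_restart hμ (β j) hr).symm
  have hprob : ∀ j, IsProbabilityMeasure ((pathLaw μ (β j)).map (restart r)) := fun j =>
    Measure.isProbabilityMeasure_map (measurable_restart r).aemeasurable
  simp_rw [hR]
  rw [← Measure.pi_map_pi fun j => (measurable_restart r).aemeasurable,
    Measure.map_map (f := fun (y : J → Bool × (ℕ → ℝ)) j => restart r (y j))
      (measurable_coverTime T 0)
      (measurable_pi_lambda _ fun j => (measurable_restart r).comp (measurable_pi_apply j))]
  refine Measure.map_congr ?_
  have hreg : ∀ᵐ y ∂(Measure.pi fun j => pathLaw μ (β j)), ∀ j, IsRegular (y j).2 :=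
    ae_all_iff.2 fun j => (Measure.quasiMeasurePreserving_eval
      (fun j => pathLaw μ (β j)) j).ae (p := fun z => IsRegular z.2)
      (ae_isRegular_pathLaw hμ (β j))
  filter_upwards [hreg] with y hy
  simp only [coverTime, Function.comp_apply, zero_add]
  have h1 := intervalIntegral.integral_comp_add_left (a := 0) (b := T)
    (fun t => 1 - noContactAt y t) r
  rw [add_zero] at h1
  rw [← h1]
  refine intervalIntegral.integral_congr fun t ht => ?_
  rw [Set.uIcc_of_le hT] at ht
  simp only [noContactAt]
  congr 1
  exact Finset.prod_congr rfl fun j _ => by rw [contactAt_add_eq_restart (hy j) hr ht.1]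

end Product

/-! ### Moments of the covered time in the stationary regime -/

section DoubleIntegral

/-- The integral of `exp (-a |t - s|)` over a square. -/
lemma integral_integral_exp_neg_abs {a T : ℝ} (ha : 0 < a) (hT : 0 ≤ T) :
    ∫ s in (0 : ℝ)..T, ∫ t in (0 : ℝ)..T, Real.exp (-(a * |t - s|))
      = 2 / a * (T - 1 / a + Real.exp (-(a * T)) / a) := by
  have hcont : ∀ s : ℝ, Continuous fun t : ℝ => Real.exp (-(a * |t - s|)) := fun s => by fun_prop
  have hinner : ∀ s ∈ Set.uIcc 0 T, ∫ t in (0 : ℝ)..T, Real.exp (-(a * |t - s|))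
      = (2 - Real.exp (-(a * s)) - Real.exp (-(a * (T - s)))) / a := fun s hs => by
    rw [Set.uIcc_of_le hT] at hs
    rw [← intervalIntegral.integral_add_adjacent_intervals
      ((hcont s).intervalIntegrable 0 s) ((hcont s).intervalIntegrable s T)]
    have h1 : ∫ t in (0 : ℝ)..s, Real.exp (-(a * |t - s|)) = (1 - Real.exp (-(a * s))) / a := by
      have hd : ∀ t ∈ Set.uIcc 0 s, HasDerivAt (fun t => Real.exp (-(a * (s - t))) / a)
          (Real.exp (-(a * |t - s|))) t := fun t ht => by
        rw [Set.uIcc_of_le hs.1] at ht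
        have := (((((hasDerivAt_id t).const_sub s).const_mul a).neg).exp).div_const a
        refine this.congr_deriv ?_
        rw [abs_of_nonpos (by linarith [ht.2])]
        simp only [id, Pi.neg_apply]
        field_simp
        ring_nf
      rw [intervalIntegral.integral_eq_sub_of_hasDerivAt hd ((hcont s).intervalIntegrable 0 s)]
      simp
      ring
    have h2 : ∫ t in s..T, Real.exp (-(a * |t - s|)) = (1 - Real.exp (-(a * (T - s)))) / a := by
      have hd : ∀ t ∈ Set.uIcc s T, HasDerivAt (fun t => -(Real.exp (-(a * (t - s))) / a))
          (Real.exp (-(a * |t - s|))) t := fun t ht => by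
        rw [Set.uIcc_of_le hs.2] at ht
        have := ((((((hasDerivAt_id t).sub_const s).const_mul a).neg).exp).div_const a).neg
        refine this.congr_deriv ?_
        rw [abs_of_nonneg (by linarith [ht.1])]
        simp only [id, Pi.neg_apply]
        field_simp
      rw [intervalIntegral.integral_eq_sub_of_hasDerivAt hd ((hcont s).intervalIntegrable s T)]
      simp
      ring
    rw [h1, h2]
    ring
  rw [intervalIntegral.integral_congr hinner]
  have hd : ∀ s ∈ Set.uIcc 0 T, HasDerivAt
      (fun s => (2 * s + Real.exp (-(a * s)) / a - Real.exp (-(a * (T - s))) / a) / a)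
      ((2 - Real.exp (-(a * s)) - Real.exp (-(a * (T - s)))) / a) s := fun s _ => by
    have h1 := ((((hasDerivAt_id s).const_mul a).neg).exp).div_const a
    have h2 := (((((hasDerivAt_id s).const_sub T).const_mul a).neg).exp).div_const a
    have h3 := (((hasDerivAt_id s).const_mul 2).add h1 |>.sub h2).div_const a
    refine h3.congr_deriv ?_
    simp only [id, Pi.neg_apply]
    field_simp
    ring
  rw [intervalIntegral.integral_eq_sub_of_hasDerivAt hd
    (Continuous.intervalIntegrable (by fun_prop) 0 T)]
  simp
  field_simp
  ring

end DoubleIntegral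

section TimeIntegral

variable {Y : Type*} [MeasurableSpace Y] (M : Measure Y) [IsProbabilityMeasure M]
  {Z : Y → ℝ → ℝ} (hZ : Measurable (Function.uncurry Z)) (hb : ∀ y t, ‖Z y t‖ ≤ 1)
include hZ hb

lemma integral_integral_process {T : ℝ} (hT : 0 ≤ T) :
    ∫ y, (∫ t in (0 : ℝ)..T, Z y t) ∂M = ∫ t in (0 : ℝ)..T, ∫ y, Z y t ∂M := by
  simp_rw [intervalIntegral.integral_of_le hT]
  exact integral_integral_swap (Integrable.of_bound hZ.aestronglyMeasurable 1
    (Eventually.of_forall fun p => hb p.1 p.2))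

lemma integral_sq_integral_process {T : ℝ} (hT : 0 ≤ T) :
    ∫ y, (∫ t in (0 : ℝ)..T, Z y t) ^ 2 ∂M
      = ∫ s in (0 : ℝ)..T, ∫ t in (0 : ℝ)..T, ∫ y, Z y s * Z y t ∂M := by
  have h1 : ∀ y, (∫ t in (0 : ℝ)..T, Z y t) ^ 2
      = ∫ s in (0 : ℝ)..T, ∫ t in (0 : ℝ)..T, Z y s * Z y t := fun y => by
    simp_rw [intervalIntegral.integral_const_mul, intervalIntegral.integral_mul_const, sq]
  simp_rw [h1]
  simp_rw [intervalIntegral.integral_of_le hT]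
  have hm : Measurable fun p : (Y × ℝ) × ℝ => Z p.1.1 p.1.2 * Z p.1.1 p.2 :=
    (hZ.comp measurable_fst).mul
      (hZ.comp ((measurable_fst.comp measurable_fst).prodMk measurable_snd))
  have hbd : ∀ y s t, ‖Z y s * Z y t‖ ≤ 1 := fun y s t => by
    rw [norm_mul]; exact mul_le_one₀ (hb y s) (norm_nonneg _) (hb y t)
  rw [integral_integral_swap]
  · refine integral_congr_ae (Eventually.of_forall fun s => ?_)
    refine integral_integral_swap (Integrable.of_bound
      (Measurable.aestronglyMeasurable ?_) 1 (Eventually.of_forall fun p => hbd p.1 s p.2))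
    exact hm.comp ((measurable_fst.prodMk measurable_const).prodMk measurable_snd)
  · have hsm := hm.stronglyMeasurable.integral_prod_right' (ν := volume.restrict (Set.Ioc 0 T))
    refine Integrable.of_bound hsm.aestronglyMeasurable
      (1 * (volume.restrict (Set.Ioc 0 T)).real Set.univ) (Eventually.of_forall fun p => ?_)
    exact norm_integral_le_of_norm_le_const (Eventually.of_forall fun t => hbd p.1 p.2 t)

end TimeIntegral

section Stationary

variable {μ : Bool → Measure ℝ} [∀ a, IsProbabilityMeasure (μ a)] {l : Bool → ℝ}
  (hl : ∀ a, 0 < l a) (hμ : ∀ a, μ a = expMeasure (l a)) {β : Measure Bool}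
  [IsProbabilityMeasure β] (hβ : β.real {true} = l false / (l true + l false))
include hl hμ hβ

lemma contactProb_stationary {t : ℝ} (ht : 0 ≤ t) :
    contactProb μ β t = l false / (l true + l false) := by
  rw [contactProb_formula hl hμ β ht, hβ, sub_self, zero_mul, add_zero]

lemma stateLaw_stationary {t : ℝ} (ht : 0 ≤ t) : stateLaw μ β t = β := by
  refine measure_bool_ext ?_
  rw [← contactProb_eq (isMemoryless_of_eq_expMeasure hl hμ) β ht,
    contactProb_stationary hl hμ hβ ht, hβ]

/-- The probability that a stationary process is out of contact at the times `s ≤ t`: by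
stationarity the first time may be taken to be `0`, when the state is the initial one. -/
lemma integral_noContact_mul_of_le {s t : ℝ} (hs : 0 ≤ s) (hst : s ≤ t) :
    ∫ y, (1 - contactAt y s) * (1 - contactAt y t) ∂(pathLaw μ β)
      = l true / (l true + l false) * (l true / (l true + l false) +
        l false / (l true + l false) * Real.exp (-((l true + l false) * (t - s)))) := by
  have hm := isMemoryless_of_eq_expMeasure hl hμ
  have hts : 0 ≤ t - s := sub_nonneg.2 hst
  have hc : l true + l false ≠ 0 := (add_pos (hl _) (hl _)).ne'
  have hmeas : Measurable fun y => (1 - contactAt y 0) * (1 - contactAt y (t - s)) :=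
    (measurable_const.sub (measurable_contactAt_const _)).mul
      (measurable_const.sub (measurable_contactAt_const _))
  have hbd : ∀ y u, ‖1 - contactAt y u‖ ≤ 1 := fun y u => by
    rcases contactAt_eq_zero_or_one y u with h | h <;> simp [h]
  have h1 : ∫ y, (1 - contactAt y s) * (1 - contactAt y t) ∂(pathLaw μ β)
      = ∫ y, (1 - contactAt y 0) * (1 - contactAt y (t - s)) ∂(pathLaw μ β) := by
    conv_rhs => rw [← stateLaw_stationary hl hμ hβ hs]
    rw [stateLaw, ← pathLaw_map_restart hm β hs,
      integral_map (measurable_restart s).aemeasurable hmeas.aestronglyMeasurable]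
    refine integral_congr_ae ?_
    filter_upwards [ae_isRegular_pathLaw hm β] with y hy
    rw [← contactAt_add_eq_restart hy hs le_rfl, ← contactAt_add_eq_restart hy hs hts, add_zero,
      add_sub_cancel]
  have h0 : ∀ a, ∀ᵐ y ∂(pathLaw μ (Measure.dirac a)),
      contactAt y 0 = if a = true then 1 else 0 := fun a => by
    rw [pathLaw_dirac]
    refine (measurableEmbedding_prodMk_left a).ae_map_iff.2 ?_
    filter_upwards [ae_phaseLaw_pos hm a] with ℓ hℓ
    have h0 : ℓ ∈ inPhase 0 0 := ⟨le_rfl, by simpa [epoch] using hℓ 0⟩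
    exact contactAt_of_mem_inPhase hℓ h0
  have htrue : ∫ y, (1 - contactAt y 0) * (1 - contactAt y (t - s))
      ∂(pathLaw μ (Measure.dirac true)) = 0 := by
    refine integral_eq_zero_of_ae ?_
    filter_upwards [h0 true] with y hy
    simp [hy]
  have hfalse : ∫ y, (1 - contactAt y 0) * (1 - contactAt y (t - s))
      ∂(pathLaw μ (Measure.dirac false)) = 1 - contactProb μ (Measure.dirac false) (t - s) := by
    have : ∫ y, (1 - contactAt y 0) * (1 - contactAt y (t - s)) ∂(pathLaw μ (Measure.dirac false))
        = ∫ y, (1 - contactAt y (t - s)) ∂(pathLaw μ (Measure.dirac false)) := by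
      refine integral_congr_ae ?_
      filter_upwards [h0 false] with y hy
      simp [hy]
    rw [this, integral_sub (integrable_const _) (integrable_contactAt _ _)]
    simp [contactProb]
  rw [h1, integral_pathLaw μ β fun a => Integrable.of_bound hmeas.aestronglyMeasurable 1
    (Eventually.of_forall fun y => by
      rw [norm_mul]; exact mul_le_one₀ (hbd _ _) (norm_nonneg _) (hbd _ _)),
    htrue, hfalse, contactProb_formula hl hμ _ hts, hβ]
  simp only [measureReal_def, Measure.dirac_apply, Set.mem_singleton_iff, Bool.false_eq_true,
    not_false_eq_true, Set.indicator_of_notMem, ENNReal.toReal_zero]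
  field_simp
  ring

lemma integral_noContact_mul {s t : ℝ} (hs : 0 ≤ s) (ht : 0 ≤ t) :
    ∫ y, (1 - contactAt y s) * (1 - contactAt y t) ∂(pathLaw μ β)
      = l true / (l true + l false) * (l true / (l true + l false) +
        l false / (l true + l false) * Real.exp (-((l true + l false) * |t - s|))) := by
  rcases le_total s t with h | h
  · rw [abs_of_nonneg (sub_nonneg.2 h), integral_noContact_mul_of_le hl hμ hβ hs h]
  · simp_rw [mul_comm (1 - contactAt _ s)]
    rw [abs_of_nonpos (sub_nonpos.2 h), neg_sub, integral_noContact_mul_of_le hl hμ hβ ht h]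

variable {J : Type*} [Fintype J]

lemma integral_noContactAt {t : ℝ} (ht : 0 ≤ t) :
    ∫ y : J → Bool × (ℕ → ℝ), noContactAt y t ∂(Measure.pi fun _ => pathLaw μ β)
      = (l true / (l true + l false)) ^ Fintype.card J := by
  have hc : l true + l false ≠ 0 := (add_pos (hl _) (hl _)).ne'
  simp_rw [noContactAt]
  rw [integral_fintype_prod_eq_pow fun z => 1 - contactAt z t,
    integral_sub (integrable_const _) (integrable_contactAt _ _)]
  change (_ - contactProb μ β t) ^ _ = _
  rw [contactProb_stationary hl hμ hβ ht]
  simp only [integral_const, probReal_univ, smul_eq_mul, mul_one]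
  congr 1
  field_simp
  ring

lemma integral_noContactAt_mul {s t : ℝ} (hs : 0 ≤ s) (ht : 0 ≤ t) :
    ∫ y : J → Bool × (ℕ → ℝ), noContactAt y s * noContactAt y t ∂(Measure.pi fun _ => pathLaw μ β)
      = (l true / (l true + l false) * (l true / (l true + l false) +
        l false / (l true + l false) * Real.exp (-((l true + l false) * |t - s|))))
          ^ Fintype.card J := by
  simp_rw [noContactAt, ← Finset.prod_mul_distrib]
  rw [integral_fintype_prod_eq_pow fun z => (1 - contactAt z s) * (1 - contactAt z t),
    integral_noContact_mul hl hμ hβ hs ht]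

omit hl hμ hβ [IsProbabilityMeasure β] [∀ a, IsProbabilityMeasure (μ a)] in
lemma coverTime_eq_sub (T : ℝ) (y : J → Bool × (ℕ → ℝ)) :
    coverTime T 0 y = T - ∫ t in (0 : ℝ)..T, noContactAt y t := by
  rw [coverTime, zero_add, intervalIntegral.integral_sub intervalIntegrable_const
    (intervalIntegrable_noContactAt y 0 T)]
  simp

omit hl hμ hβ [IsProbabilityMeasure β] [∀ a, IsProbabilityMeasure (μ a)] in
lemma norm_noContactAt_le (y : J → Bool × (ℕ → ℝ)) (t : ℝ) : ‖noContactAt y t‖ ≤ 1 := by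
  rw [Real.norm_of_nonneg (noContactAt_mem_Icc y t).1]
  exact (noContactAt_mem_Icc y t).2

omit hl hμ hβ [IsProbabilityMeasure β] [∀ a, IsProbabilityMeasure (μ a)] in
lemma memLp_noContactTime {T : ℝ} (hT : 0 ≤ T) (m : Measure (J → Bool × (ℕ → ℝ)))
    [IsFiniteMeasure m] : MemLp (fun y => ∫ t in (0 : ℝ)..T, noContactAt y t) 2 m := by
  have h : (fun y : J → Bool × (ℕ → ℝ) => ∫ t in (0 : ℝ)..T, noContactAt y t)
      = fun y => T - coverTime T 0 y := by
    funext y; rw [coverTime_eq_sub]; ring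
  rw [h]
  refine MemLp.of_bound (measurable_const.sub (measurable_coverTime T 0)).aestronglyMeasurable T
    (Eventually.of_forall fun y => ?_)
  have := coverTime_mem_Icc hT 0 y
  rw [Real.norm_of_nonneg (by linarith)]
  linarith

lemma integral_noContactTime {T : ℝ} (hT : 0 ≤ T) :
    ∫ y : J → Bool × (ℕ → ℝ), (∫ t in (0 : ℝ)..T, noContactAt y t)
        ∂(Measure.pi fun _ => pathLaw μ β)
      = T * (l true / (l true + l false)) ^ Fintype.card J := by
  rw [integral_integral_process _ measurable_noContactAt norm_noContactAt_le hT]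
  rw [intervalIntegral.integral_congr (g := fun _ => (l true / (l true + l false)) ^ Fintype.card J)
    fun t ht => integral_noContactAt hl hμ hβ (by rw [Set.uIcc_of_le hT] at ht; exact ht.1)]
  simp

/-- The expected time covered in a window by independent stationary processes. -/
lemma integral_coverTime {T : ℝ} (hT : 0 ≤ T) :
    ∫ y : J → Bool × (ℕ → ℝ), coverTime T 0 y ∂(Measure.pi fun _ => pathLaw μ β)
      = T * (1 - (l true / (l true + l false)) ^ Fintype.card J) := by
  simp_rw [coverTime_eq_sub]
  rw [integral_sub (integrable_const _)
    ((memLp_noContactTime hT _).integrable (by norm_num)), integral_noContactTime hl hμ hβ hT]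
  simp
  ring

/-- The variance of the time covered in a window by independent stationary processes. -/
lemma variance_coverTime {T : ℝ} (hT : 0 ≤ T) :
    Var[fun y : J → Bool × (ℕ → ℝ) => coverTime T 0 y; Measure.pi fun _ => pathLaw μ β]
      = 2 * (l true / (l true + l false) ^ 2) ^ Fintype.card J *
          ∑ k ∈ Finset.Icc 1 (Fintype.card J), ((Fintype.card J).choose k : ℝ) *
            (l true ^ (Fintype.card J - k) * l false ^ k / (k * (l true + l false))) *
            (T - 1 / (k * (l true + l false)) +
              Real.exp (-(k * (l true + l false) * T)) / (k * (l true + l false))) := by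
  have hLp := memLp_noContactTime (J := J) hT (Measure.pi fun _ => pathLaw μ β)
  set n := Fintype.card J with hn
  set c := l true + l false with hc
  have hcpos : 0 < c := add_pos (hl _) (hl _)
  simp_rw [coverTime_eq_sub]
  rw [variance_const_sub hLp.aestronglyMeasurable, variance_eq_sub hLp,
    integral_noContactTime hl hμ hβ hT]
  simp only [Pi.pow_apply]
  rw [integral_sq_integral_process _ measurable_noContactAt norm_noContactAt_le hT]
  -- Binomial expansion of the covariance kernel; the term of index `0` is the squared mean.
  have hexp : ∀ s ∈ Set.uIcc 0 T, ∫ t in (0 : ℝ)..T,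
        ∫ y : J → Bool × (ℕ → ℝ), noContactAt y s * noContactAt y t
          ∂(Measure.pi fun _ => pathLaw μ β)
      = ∑ k ∈ Finset.range (n + 1), (l true / c) ^ n *
        ((l false / c) ^ k * (l true / c) ^ (n - k) * (n.choose k : ℝ)) *
          ∫ t in (0 : ℝ)..T, Real.exp (-(k * c * |t - s|)) := fun s hs => by
    rw [Set.uIcc_of_le hT] at hs
    have : ∀ t ∈ Set.uIcc 0 T, ∫ y : J → Bool × (ℕ → ℝ), noContactAt y s * noContactAt y t
          ∂(Measure.pi fun _ => pathLaw μ β)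
        = ∑ k ∈ Finset.range (n + 1), (l true / c) ^ n *
        ((l false / c) ^ k * (l true / c) ^ (n - k) * (n.choose k : ℝ)) *
          Real.exp (-(k * c * |t - s|)) := fun t ht => by
      rw [Set.uIcc_of_le hT] at ht
      rw [integral_noContactAt_mul hl hμ hβ hs.1 ht.1, mul_pow, add_comm (l true / _), add_pow,
        Finset.mul_sum]
      refine Finset.sum_congr rfl fun k _ => ?_
      rw [mul_pow, ← Real.exp_nat_mul, show -(k * c * |t - s|) = k * -(c * |t - s|) by ring]
      ring
    rw [intervalIntegral.integral_congr this, intervalIntegral.integral_finsetSum fun k _ =>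
      Continuous.intervalIntegrable (by fun_prop) 0 T]
    simp_rw [intervalIntegral.integral_const_mul]
  have hcontI : ∀ k : ℕ, Continuous fun s : ℝ =>
      ∫ t in (0 : ℝ)..T, Real.exp (-(k * c * |t - s|)) := fun k =>
    intervalIntegral.continuous_parametric_intervalIntegral_of_continuous' (by fun_prop) 0 T
  rw [intervalIntegral.integral_congr hexp, intervalIntegral.integral_finsetSum fun k _ =>
      ((hcontI k).const_mul _).intervalIntegrable 0 T]
  simp_rw [intervalIntegral.integral_const_mul]
  have hrange : Finset.range (n + 1) = insert 0 (Finset.Icc 1 n) := by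
    ext k; simp; omega
  rw [hrange, Finset.sum_insert (by simp)]
  have h0 : ∫ s in (0 : ℝ)..T, ∫ t in (0 : ℝ)..T, Real.exp (-(((0 : ℕ) : ℝ) * c * |t - s|))
      = T * T := by simp
  rw [h0, Finset.mul_sum]
  simp only [pow_zero, Nat.sub_zero, Nat.choose_zero_right, Nat.cast_one, one_mul, mul_one]
  rw [show (l true / c) ^ n * (l true / c) ^ n * (T * T) = (T * (l true / c) ^ n) ^ 2 by ring,
    add_sub_cancel_left]
  refine Finset.sum_congr rfl fun k hk => ?_
  obtain ⟨hk1, hkn⟩ := Finset.mem_Icc.1 hk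
  have hkpos : (0 : ℝ) < k := by exact_mod_cast hk1
  rw [integral_integral_exp_neg_abs (mul_pos hkpos hcpos) hT]
  have h1 : (l false / c) ^ k * (l true / c) ^ (n - k)
      = l true ^ (n - k) * l false ^ k / c ^ n := by
    rw [div_pow, div_pow, div_mul_div_comm, ← pow_add, Nat.add_sub_cancel' hkn, mul_comm]
  rw [h1, div_pow, div_pow, ← pow_mul, mul_comm 2 n, pow_mul]
  field_simp

end Stationary

/-! ### The mobility model -/

/-- The path of a pair, read off from its initial state, its contact times and its inter-contact
times: the initial state together with the lengths of the successive phases. -/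
noncomputable def pathOf (z : Bool × (ℕ → ℝ) × (ℕ → ℝ)) : Bool × (ℕ → ℝ) :=
  (z.1, phaseLength z.1 z.2.1 z.2.2)

lemma measurable_phaseLength (s : Bool) :
    Measurable fun p : (ℕ → ℝ) × (ℕ → ℝ) => phaseLength s p.1 p.2 := by
  refine measurable_pi_lambda _ fun n => ?_
  unfold phaseLength
  split_ifs <;> fun_prop

lemma measurable_pathOf : Measurable pathOf := by
  refine measurable_from_prod_countable_right fun s => ?_
  exact measurable_const.prodMk (measurable_phaseLength s)

/-- The index, among all contact times (left) and inter-contact times (right), of the length of the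
`n`-th phase. -/
def phaseSlot (s : Bool) (n : ℕ) : ℕ ⊕ ℕ :=
  if phaseState s n = true then Sum.inl (n / 2) else Sum.inr (n / 2)

lemma phaseSlot_injective (s : Bool) : Function.Injective (phaseSlot s) := by
  intro m n h
  unfold phaseSlot phaseState at h
  have hm := Nat.div_add_mod m 2
  have hn := Nat.div_add_mod n 2
  rcases Nat.mod_two_eq_zero_or_one m with h1 | h1 <;>
    rcases Nat.mod_two_eq_zero_or_one n with h2 | h2 <;>
    cases s <;> simp [h1, h2] at h <;> omega

lemma elim_phaseSlot {Ω : Type*} (s : Bool) (c d : ℕ → Ω → ℝ) (n : ℕ) (ω : Ω) :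
    Sum.elim c d (phaseSlot s n) ω = phaseLength s (fun k => c k ω) (fun k => d k ω) n := by
  unfold phaseSlot phaseLength
  split_ifs <;> rfl

section Model

variable {U Ω : Type*} [MeasurableSpace Ω] {P : Measure Ω} [IsProbabilityMeasure P]
  {lamC lamI : Sym2 U → ℝ} {start : Sym2 U → Ω → Bool} {con int : Sym2 U → ℕ → Ω → ℝ}
  {μ : Bool → Measure ℝ} [∀ a, IsProbabilityMeasure (μ a)]

omit [IsProbabilityMeasure P] in
lemma IsMobilityModel.measurable_timeline (h : IsMobilityModel lamC lamI start con int P)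
    {e : Sym2 U} (he : ¬ e.IsDiag) :
    Measurable fun ω => (start e ω, fun k => con e k ω, fun k => int e k ω) :=
  (h.measurable_start e he).prodMk ((measurable_pi_lambda _ fun k => h.measurable_con e he k).prodMk
    (measurable_pi_lambda _ fun k => h.measurable_int e he k))

/-- The lengths of the phases that follow a fixed initial state are the terms of a subfamily of the
contact and inter-contact times, hence independent. -/
lemma IsMobilityModel.map_phaseLength (h : IsMobilityModel lamC lamI start con int P)
    {e : Sym2 U} (he : ¬ e.IsDiag) (hC : μ true = expMeasure (lamC e))
    (hI : μ false = expMeasure (lamI e)) (s : Bool) :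
    P.map (fun ω => phaseLength s (fun k => con e k ω) (fun k => int e k ω)) = phaseLaw μ s := by
  have hm : ∀ q, Measurable (Sum.elim (con e) (int e) q) := by
    rintro (k | k)
    exacts [h.measurable_con e he k, h.measurable_int e he k]
  have hind := (h.indep_durations e he).precomp (phaseSlot_injective s)
  have hmap := (iIndepFun_iff_map_fun_eq_infinitePi_map fun n => hm (phaseSlot s n)).1 hind
  have hlaw : ∀ n, P.map (Sum.elim (con e) (int e) (phaseSlot s n)) = μ (phaseState s n) :=
    fun n => by
      unfold phaseSlot
      cases hn : phaseState s n
      · simpa [hI] using h.law_int e he _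
      · simpa [hC] using h.law_con e he _
  simp_rw [hlaw] at hmap
  rw [phaseLaw, ← hmap]
  congr 1
  funext ω n
  exact (elim_phaseSlot s (con e) (int e) n ω).symm

lemma IsMobilityModel.map_pathOf (h : IsMobilityModel lamC lamI start con int P)
    {e : Sym2 U} (he : ¬ e.IsDiag) (hC : μ true = expMeasure (lamC e))
    (hI : μ false = expMeasure (lamI e)) :
    P.map (fun ω => pathOf (start e ω, fun k => con e k ω, fun k => int e k ω))
      = pathLaw μ (P.map (start e)) := by
  have hs := h.measurable_start e he
  have hdur : Measurable fun ω => (fun k => con e k ω, fun k => int e k ω) :=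
    measurable_snd.comp (h.measurable_timeline he)
  ext B hB
  have hBs : ∀ a, MeasurableSet (Prod.mk a ⁻¹' B) := fun a => measurable_prodMk_left hB
  have hph : ∀ a, Measurable fun ω => phaseLength a (fun k => con e k ω) (fun k => int e k ω) :=
    fun a => (measurable_phaseLength a).comp hdur
  have hpart : ∀ a, P (start e ⁻¹' {a} ∩
      (fun ω => phaseLength a (fun k => con e k ω) (fun k => int e k ω)) ⁻¹' (Prod.mk a ⁻¹' B))
      = P.map (start e) {a} * phaseLaw μ a (Prod.mk a ⁻¹' B) := fun a => by
    have hi := (h.indep_start e he).measure_inter_preimage_eq_mul {a}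
      ((fun p : (ℕ → ℝ) × (ℕ → ℝ) => phaseLength a p.1 p.2) ⁻¹' (Prod.mk a ⁻¹' B))
      (measurableSet_singleton a) (measurable_phaseLength a (hBs a))
    rw [← h.map_phaseLength he hC hI a, Measure.map_apply hs (measurableSet_singleton a),
      Measure.map_apply (hph a) (hBs a)]
    exact hi
  rw [Measure.map_apply
    (f := fun ω => pathOf (start e ω, fun k => con e k ω, fun k => int e k ω))
    (measurable_pathOf.comp (h.measurable_timeline he)) hB,
    pathLaw_apply μ _ hB]
  simp_rw [← hpart]
  rw [Fintype.sum_bool, ← measure_union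
    (Set.disjoint_left.2 fun ω h1 h2 => by
      have e1 : start e ω = true := h1.1
      have e2 : start e ω = false := h2.1
      simp [e1] at e2)
    ((hs (measurableSet_singleton false)).inter (hph false (hBs false)))]
  congr 1
  ext ω
  simp only [Set.mem_preimage, Set.mem_union, Set.mem_inter_iff, Set.mem_singleton_iff, pathOf]
  cases start e ω <;> simp

variable {F : Type*} [Fintype U] [DecidableEq U]

/-- The paths of the pairs formed by `i` and the other users caching `f`. -/
noncomputable def cachingPaths (x : U → F → Bool) (start : Sym2 U → Ω → Bool)
    (con int : Sym2 U → ℕ → Ω → ℝ) (i : U) (f : F) (ω : Ω) (j : {j // j ≠ i ∧ x j f = true}) :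
    Bool × (ℕ → ℝ) :=
  pathOf (start s(i, j) ω, fun k => con s(i, j) k ω, fun k => int s(i, j) k ω)

omit [MeasurableSpace Ω] in
lemma windowTime_eq_coverTime (x : U → F → Bool) (i : U) (f : F) (T r : ℝ) (ω : Ω) :
    windowTime x start con int i f T r ω
      = coverTime T r (cachingPaths x start con int i f ω) := by
  unfold windowTime coverTime
  congr 1
  funext t
  unfold fileAvailable noContactAt
  rw [Finset.prod_subtype (p := fun j => j ≠ i ∧ x j f = true) _ fun j => by simp]
  -- `contactIndicator` and `contactAt ∘ pathOf` agree by definition.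
  rfl

omit [Fintype U] [DecidableEq U] in
lemma not_isDiag_of_ne {i j : U} (h : j ≠ i) : ¬ s(i, j).IsDiag := by
  simpa using h.symm

omit [IsProbabilityMeasure P] [Fintype U] [DecidableEq U] in
lemma IsMobilityModel.measurable_cachingPaths (h : IsMobilityModel lamC lamI start con int P)
    (x : U → F → Bool) (i : U) (f : F) : Measurable (cachingPaths x start con int i f) :=
  measurable_pi_lambda _ fun j =>
    measurable_pathOf.comp (h.measurable_timeline (not_isDiag_of_ne j.2.1))

/-- Different users `j` give different pairs `s(i, j)`, whose paths are independent. -/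
lemma IsMobilityModel.map_cachingPaths (h : IsMobilityModel lamC lamI start con int P)
    (hC : ∀ i j : U, i ≠ j → μ true = expMeasure (lamC s(i, j)))
    (hI : ∀ i j : U, i ≠ j → μ false = expMeasure (lamI s(i, j)))
    (x : U → F → Bool) (i : U) (f : F) :
    P.map (cachingPaths x start con int i f) =
      Measure.pi fun j : {j // j ≠ i ∧ x j f = true} => pathLaw μ (P.map (start s(i, j))) := by
  let g : {j // j ≠ i ∧ x j f = true} → {e : Sym2 U // ¬ e.IsDiag} := fun j =>
    ⟨s(i, j), not_isDiag_of_ne j.2.1⟩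
  have hg : Function.Injective g := fun j k hjk => by
    have h1 : s(i, (j : U)) = s(i, (k : U)) := congrArg Subtype.val hjk
    exact Subtype.ext (Sym2.congr_right.1 h1)
  have hind := (h.indep_pairs.precomp hg).comp (fun _ => pathOf) fun _ => measurable_pathOf
  have hmap := (iIndepFun_iff_map_fun_eq_pi_map fun j =>
    (measurable_pathOf.comp (h.measurable_timeline (g j).2)).aemeasurable).1 hind
  refine hmap.trans ?_
  congr 1
  funext j
  exact h.map_pathOf (g j).2 (hC i j j.2.1.symm) (hI i j j.2.1.symm)

omit [MeasurableSpace Ω] in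
lemma card_caching (x : U → F → Bool) {i : U} {f : F} (hif : x i f = false) :
    Fintype.card {j // j ≠ i ∧ x j f = true} = cachingCount x f := by
  rw [Fintype.card_subtype, cachingCount, Finset.card_filter]
  refine Finset.sum_congr rfl fun j _ => ?_
  by_cases hj : j = i
  · subst hj; simp [hif]
  · cases hx : x j f <;> simp [hj]

end Model

end D2D

open D2D in
theorem corollary1 {U : Type*} {F : Type*} [Fintype U] [DecidableEq U]
    {Ω : Type*} [MeasurableSpace Ω] (P : MeasureTheory.Measure Ω)
    [MeasureTheory.IsProbabilityMeasure P]
    (lamC lamI : Sym2 U → ℝ) (start : Sym2 U → Ω → Bool) (con int : Sym2 U → ℕ → Ω → ℝ)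
    (hmodel : D2D.IsMobilityModel lamC lamI start con int P)
    (lC lI : ℝ) (hlC : 0 < lC) (hlI : 0 < lI)
    (hhomC : ∀ i j : U, i ≠ j → lamC s(i, j) = lC)
    (hhomI : ∀ i j : U, i ≠ j → lamI s(i, j) = lI)
    (x : U → F → Bool) (i : U) (f : F) (hif : x i f = false) (Td : ℝ) (hTd : 0 < Td) :
    (∃ (ν : MeasureTheory.Measure ℝ) (_ : MeasureTheory.IsProbabilityMeasure ν),
      D2D.IsCommunicationTime x start con int P i f Td (fun y : ℝ => y) ν) ∧
    ∀ (Ω' : Type*) [MeasurableSpace Ω'] (Q : MeasureTheory.Measure Ω')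
      [MeasureTheory.IsProbabilityMeasure Q] (Tc : Ω' → ℝ),
      D2D.IsCommunicationTime x start con int P i f Td Tc Q →
        MeasureTheory.MemLp Tc 2 Q ∧
        ∫ ω, Tc ω ∂Q = Td * (1 - (lC / (lC + lI)) ^ D2D.cachingCount x f) ∧
        ProbabilityTheory.variance Tc Q =
          2 * (lC / (lC + lI) ^ 2) ^ D2D.cachingCount x f *
            ∑ l ∈ Finset.Icc 1 (D2D.cachingCount x f),
              ((D2D.cachingCount x f).choose l : ℝ) *
                (lC ^ (D2D.cachingCount x f - l) * lI ^ l / (l * (lC + lI))) *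
                (Td - 1 / (l * (lC + lI)) +
                  Real.exp (-(l * (lC + lI) * Td)) / (l * (lC + lI))) := by
  let l : Bool → ℝ := fun a => if a = true then lC else lI
  have hl : ∀ a, 0 < l a := fun a => by cases a <;> simp [l, hlC, hlI]
  let μ : Bool → Measure ℝ := fun a => expMeasure (l a)
  have hμ : ∀ a, μ a = expMeasure (l a) := fun _ => rfl
  have : ∀ a, IsProbabilityMeasure (μ a) := fun a => isProbabilityMeasure_expMeasure (hl a)
  have hm := isMemoryless_of_eq_expMeasure hl hμ
  have hc : 0 < lC + lI := add_pos hlC hlI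
  obtain ⟨β, hβ, hβp⟩ := exists_isProbabilityMeasure_bool (p := lI / (lC + lI)) (by positivity)
    ((div_le_one hc).2 (by linarith))
  have hβl : β.real {true} = l false / (l true + l false) := by simpa [l] using hβp
  -- The initial states of the pairs, and the joint law of the stationary paths.
  have hst : ∀ j : {j // j ≠ i ∧ x j f = true}, IsProbabilityMeasure (P.map (start s(i, j))) :=
    fun j => Measure.isProbabilityMeasure_map
      (hmodel.measurable_start _ (not_isDiag_of_ne j.2.1)).aemeasurable
  let M : Measure ({j // j ≠ i ∧ x j f = true} → Bool × (ℕ → ℝ)) :=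
    Measure.pi fun _ => pathLaw μ β
  have hcov := measurable_coverTime (J := {j // j ≠ i ∧ x j f = true}) Td 0
  have hpaths := hmodel.measurable_cachingPaths x i f
  have hwin : ∀ r, Measurable fun ω => windowTime x start con int i f Td r ω := fun r => by
    simp_rw [windowTime_eq_coverTime]
    exact (measurable_coverTime Td r).comp hpaths
  have hlaw : ∀ r, 0 ≤ r → P.map (fun ω => windowTime x start con int i f Td r ω)
      = (Measure.pi fun j : {j // j ≠ i ∧ x j f = true} =>
          pathLaw μ (stateLaw μ (P.map (start s(i, j))) r)).map (coverTime Td 0) := fun r hr => by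
    rw [← map_coverTime hm (fun j : {j // j ≠ i ∧ x j f = true} => P.map (start s(i, j))) hTd.le hr,
      ← hmodel.map_cachingPaths (fun i j hij => by simp [hμ, l, hhomC i j hij])
        (fun i j hij => by simp [hμ, l, hhomI i j hij]),
      Measure.map_map (measurable_coverTime Td r) hpaths]
    congr 1
    funext ω
    exact windowTime_eq_coverTime x i f Td r ω
  have hstate : ∀ j : {j // j ≠ i ∧ x j f = true},
      Tendsto (fun r => (stateLaw μ (P.map (start s(i, j))) r).real {true}) atTop
        (nhds (β.real {true})) := fun j => by
    have hexp : Tendsto (fun r : ℝ => Real.exp (-((l true + l false) * r))) atTop (nhds 0) :=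
      Real.tendsto_exp_neg_atTop_nhds_zero.comp
        (tendsto_id.const_mul_atTop (add_pos (hl true) (hl false)))
    have h1 := (hexp.const_mul ((P.map (start s(i, j))).real {true}
      - l false / (l true + l false))).const_add (l false / (l true + l false))
    rw [mul_zero, add_zero, ← hβl] at h1
    refine h1.congr' ?_
    filter_upwards [eventually_ge_atTop 0] with r hr
    rw [← contactProb_eq hm _ hr, contactProb_formula hl hμ _ hr, hβl]
  have hMprob : IsProbabilityMeasure (M.map (coverTime Td 0)) :=
    Measure.isProbabilityMeasure_map hcov.aemeasurable
  have hlim : IsCommunicationTime x start con int P i f Td (fun y : ℝ => y)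
      (M.map (coverTime Td 0)) := by
    refine ⟨fun r => (hwin r).aemeasurable, measurable_id.aemeasurable, ?_⟩
    refine ProbabilityMeasure.tendsto_iff_forall_integral_tendsto.2 fun G => ?_
    simp only [ProbabilityMeasure.coe_mk, Measure.map_id']
    have h1 := tendsto_integral_pi_pathLaw μ (L := atTop)
      (B := fun r (j : {j // j ≠ i ∧ x j f = true}) => stateLaw μ (P.map (start s(i, j))) r)
      (β := fun _ => β) hstate (G := fun y => G (coverTime Td 0 y))
      (G.continuous.measurable.comp hcov) (C := ‖G‖) fun y => G.norm_coe_le_norm _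
    rw [integral_map hcov.aemeasurable G.continuous.measurable.aestronglyMeasurable]
    refine h1.congr' ?_
    filter_upwards [eventually_ge_atTop 0] with r hr
    rw [hlaw r hr, integral_map hcov.aemeasurable G.continuous.measurable.aestronglyMeasurable]
  refine ⟨⟨_, hMprob, hlim⟩, fun Ω' _ Q _ Tc hTc => ?_⟩
  -- The law of a limit in distribution is unique.
  have huniq : Q.map Tc = M.map (coverTime Td 0) := by
    have h1 := tendstoInDistribution_unique _ hTc hlim
    rwa [Measure.map_id'] at h1
  have hTcm : AEMeasurable Tc Q := hTc.aemeasurable_limit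
  have hid : MemLp id 2 (M.map (coverTime Td 0)) := by
    rw [memLp_map_measure_iff measurable_id.aestronglyMeasurable hcov.aemeasurable]
    refine MemLp.of_bound hcov.aestronglyMeasurable Td (Eventually.of_forall fun y => ?_)
    have := coverTime_mem_Icc hTd.le 0 y
    rw [Function.comp_apply, id, Real.norm_of_nonneg this.1]
    exact this.2
  refine ⟨?_, ?_, ?_⟩
  · rw [← huniq, memLp_map_measure_iff measurable_id.aestronglyMeasurable hTcm] at hid
    exact hid
  · have h1 : ∫ ω, Tc ω ∂Q = ∫ u, u ∂(Q.map Tc) :=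
      (integral_map hTcm measurable_id.aestronglyMeasurable).symm
    rw [h1, huniq, integral_map (f := fun u => u) hcov.aemeasurable
        measurable_id.aestronglyMeasurable,
      integral_coverTime hl hμ hβl hTd.le, card_caching x hif]
    simp [l]
  · have h1 : Var[Tc; Q] = Var[id; Q.map Tc] := by
      rw [variance_map measurable_id.aemeasurable hTcm]; rfl
    have h2 := variance_coverTime (J := {j // j ≠ i ∧ x j f = true}) hl hμ hβl hTd.le
    rw [card_caching x hif] at h2
    rw [h1, huniq, variance_map measurable_id.aemeasurable hcov.aemeasurable]
    simpa [l] using h2
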